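/- Let $A$ be a normal noetherian domain. Let $\operatorname{Div} A$ be the group of Weil divisors of $\operatorname{Spec} A$, i.e. the free abelian group on the prime ideals of height one. A divisor $D$ is called \emph{coaffine} if for every effective divisor $E$ linearly equivalent to $D$ the open subscheme $\operatorname{Spec} A \setminus \operatorname{Supp} E$ is affine; \emph{strongly coaffine} if for every $n \in \mathbb{Z}$ the divisor $nD$ is coaffine or trivial (linearly equivalent to $0$); and \emph{affine trivial} if $D + E$ is strongly coaffine for every strongly coaffine divisor $E$. The affine trivial divisors form a subgroup of $\operatorname{Div} A$, and the quotient of $\operatorname{Div} A$ by it is the affine class group $\operatorname{ACl} A$. (1) The affine class groups of $A$ and of the polynomial ring $A[T]$ coincide: the pull-back of divisors $\operatorname{Div} A \to \operatorname{Div} A[T]$, $\mathfrak{p} \mapsto \mathfrak{p}A[T]$, induces an isomorphism $\operatorname{ACl} A \cong \operatorname{ACl} A[T]$. (2) If the complement of every hypersurface (closed subset of pure codimension one) in $\operatorname{Spec} A$ is affine, then the complement of every hypersurface in $\operatorname{Spec} A[T]$ is affine. -/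

import Mathlib

open AlgebraicGeometry

universe u

noncomputable section

namespace AffineClassGroup

/-- A prime divisor of `Spec A`: a point of codimension one, i.e. a prime ideal of height one. -/
abbrev PrimeDivisor (A : Type u) [CommRing A] : Type u :=
  {p : PrimeSpectrum A // p.asIdeal.height = 1}

/-- The group `Div A` of Weil divisors of `Spec A`, the free abelian group on the prime divisors.
It is ordered coefficientwise; a divisor `D` is effective if `0 ≤ D`. -/
abbrev WeilDivisor (A : Type u) [CommRing A] : Type u := PrimeDivisor A →₀ ℤ

/-- The support of a divisor, as a closed subset of `Spec A`: the union of the closed sets `V(p)`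
over the prime divisors `p` that occur with nonzero coefficient. -/
def supp {A : Type u} [CommRing A] (D : WeilDivisor A) : Set (PrimeSpectrum A) :=
  ⋃ P ∈ D.support, PrimeSpectrum.zeroLocus (P.1.asIdeal : Set A)

/-- The complement of `Z` in the scheme `Spec A` is open, and affine as an open subscheme. -/
def HasAffineComplement {A : Type u} [CommRing A] (Z : Set (PrimeSpectrum A)) : Prop :=
  ∃ U : (Spec (CommRingCat.of A)).Opens,
    (U : Set (Spec (CommRingCat.of A))) = (Zᶜ : Set (PrimeSpectrum A)) ∧ IsAffineOpen U

/-- A hypersurface in `Spec A`: a closed subset of pure codimension one, i.e. the generic point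
of each irreducible component of `Z` is a prime ideal of height one. -/
def IsHypersurface {A : Type u} [CommRing A] (Z : Set (PrimeSpectrum A)) : Prop :=
  IsClosed Z ∧ ∀ p ∈ (PrimeSpectrum.vanishingIdeal Z).minimalPrimes, p.height = 1

/-- The local ring of a normal noetherian domain at a prime divisor is a discrete valuation
ring. -/
instance isDiscreteValuationRing_localization {A : Type u} [CommRing A] [IsDomain A]
    [IsNoetherianRing A] [IsIntegrallyClosed A] (P : PrimeDivisor A) :
    IsDiscreteValuationRing (Localization.AtPrime P.1.asIdeal) := by
  have hdim : ringKrullDim (Localization.AtPrime P.1.asIdeal) = 1 := by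
    rw [IsLocalization.AtPrime.ringKrullDim_eq_height P.1.asIdeal, P.2]
    rfl
  have hf : ¬ IsField (Localization.AtPrime P.1.asIdeal) := by
    intro h
    rw [ringKrullDim_eq_zero_of_isField h] at hdim
    exact zero_ne_one hdim
  have hic : IsIntegrallyClosed (Localization.AtPrime P.1.asIdeal) :=
    isIntegrallyClosed_of_isLocalization _ P.1.asIdeal.primeCompl
      P.1.asIdeal.primeCompl_le_nonZeroDivisors
  have hle : Ring.KrullDimLE 1 (Localization.AtPrime P.1.asIdeal) := by
    rw [Ring.krullDimLE_iff, hdim]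
    rfl
  have huniq : ∃! Q : Ideal (Localization.AtPrime P.1.asIdeal), Q ≠ ⊥ ∧ Q.IsPrime := by
    refine ⟨IsLocalRing.maximalIdeal _,
      ⟨fun h => hf (IsLocalRing.isField_iff_maximalIdeal_eq.mpr h), inferInstance⟩, ?_⟩
    rintro Q ⟨hQ, hQp⟩
    have : Q.IsMaximal := (Ring.krullDimLE_one_iff_of_isPrime_bot.mp hle) Q hQ hQp
    exact IsLocalRing.eq_maximalIdeal this
  have h := (IsDiscreteValuationRing.TFAE (Localization.AtPrime P.1.asIdeal) hf).out 0 3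
  exact h.mpr (And.intro hic huniq)

/-- The order of vanishing of a nonzero `a : A` along the prime divisor `P`: the normalized
valuation of `a` in the discrete valuation ring `A_P` (with the value `0` at `a = 0`). -/
def ord {A : Type u} [CommRing A] [IsDomain A] [IsNoetherianRing A] [IsIntegrallyClosed A]
    (P : PrimeDivisor A) (a : A) : ℤ :=
  ((IsDiscreteValuationRing.addVal (Localization.AtPrime P.1.asIdeal)
    (algebraMap A (Localization.AtPrime P.1.asIdeal) a)).toNat : ℤ)

/-- An element of a normal noetherian domain vanishes along finitely many prime divisors. -/
theorem finite_support_ord {A : Type u} [CommRing A] [IsDomain A] [IsNoetherianRing A]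
    [IsIntegrallyClosed A] (a : A) :
    (Function.support fun P : PrimeDivisor A => ord P a).Finite := by
  rcases eq_or_ne a 0 with rfl | ha
  · convert Set.finite_empty
    ext P
    simp [ord]
  refine Set.Finite.of_injOn (f := fun P : PrimeDivisor A => P.1.asIdeal)
    (t := (Ideal.span {a}).minimalPrimes) ?_ ?_
    (Ideal.finite_minimalPrimes_of_isNoetherianRing A _)
  · intro P hP
    have hmem : a ∈ P.1.asIdeal := by
      by_contra h
      apply hP
      have hu : IsUnit (algebraMap A (Localization.AtPrime P.1.asIdeal) a) :=
        IsLocalization.map_units (M := P.1.asIdeal.primeCompl) _ ⟨a, h⟩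
      simp [ord, IsDiscreteValuationRing.addVal_eq_zero_iff.mpr hu]
    refine ⟨⟨P.1.isPrime, by simpa [Ideal.span_le] using hmem⟩, ?_⟩
    rintro Q ⟨hQ, haQ⟩ hQP
    by_contra hne
    have hlt : Q < P.1.asIdeal := lt_of_le_not_ge hQP hne
    have h0 : Q.height < (1 : ℕ) :=
      Ideal.height_le_iff.mp (le_of_eq (by simpa using P.2)) Q hQ hlt
    have hQ0 : Q = ⊥ := by
      rw [← Ideal.height_eq_zero_iff_eq_bot]
      simpa using h0
    apply ha
    have := haQ (Ideal.mem_span_singleton_self a)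
    simpa [hQ0] using this
  · intro P _ Q _ h
    exact Subtype.ext (PrimeSpectrum.ext h)

/-- The divisor `(a)` of a nonzero element `a` of `A`. -/
def div {A : Type u} [CommRing A] [IsDomain A] [IsNoetherianRing A] [IsIntegrallyClosed A]
    (a : A) : WeilDivisor A :=
  Finsupp.ofSupportFinite (fun P => ord P a) (finite_support_ord a)

/-- Linear equivalence of divisors: `E = D + (q)` for some nonzero element `q = a / b` of the
field of fractions of `A`, where `(a / b) = (a) - (b)`. -/
def LinearlyEquivalent {A : Type u} [CommRing A] [IsDomain A] [IsNoetherianRing A]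
    [IsIntegrallyClosed A] (D E : WeilDivisor A) : Prop :=
  ∃ a b : A, a ≠ 0 ∧ b ≠ 0 ∧ E = D + (div a - div b)

/-- `D` is coaffine if every effective divisor linearly equivalent to `D` has affine
complement. -/
def Coaffine {A : Type u} [CommRing A] [IsDomain A] [IsNoetherianRing A] [IsIntegrallyClosed A]
    (D : WeilDivisor A) : Prop :=
  ∀ E : WeilDivisor A, 0 ≤ E → LinearlyEquivalent D E → HasAffineComplement (supp E)

/-- `D` is strongly coaffine if every multiple `nD`, `n ∈ ℤ`, is coaffine or trivial in the
divisor class group. -/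
def StronglyCoaffine {A : Type u} [CommRing A] [IsDomain A] [IsNoetherianRing A]
    [IsIntegrallyClosed A] (D : WeilDivisor A) : Prop :=
  ∀ n : ℤ, Coaffine (n • D) ∨ LinearlyEquivalent (n • D) 0

theorem StronglyCoaffine.neg {A : Type u} [CommRing A] [IsDomain A] [IsNoetherianRing A]
    [IsIntegrallyClosed A] {D : WeilDivisor A} (h : StronglyCoaffine D) :
    StronglyCoaffine (-D) := by
  intro n
  have h' := h (-n)
  rwa [neg_smul, ← smul_neg] at h'

/-- `D` is affine trivial if adding `D` preserves strongly coaffine divisors. -/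
def AffineTrivial {A : Type u} [CommRing A] [IsDomain A] [IsNoetherianRing A]
    [IsIntegrallyClosed A] (D : WeilDivisor A) : Prop :=
  ∀ E : WeilDivisor A, StronglyCoaffine E → StronglyCoaffine (D + E)

/-- The subgroup of affine trivial divisors. -/
def affineTrivialSubgroup (A : Type u) [CommRing A] [IsDomain A] [IsNoetherianRing A]
    [IsIntegrallyClosed A] : AddSubgroup (WeilDivisor A) where
  carrier := {D | AffineTrivial D}
  zero_mem' := fun E hE => by rwa [zero_add]
  add_mem' := fun {D D'} hD hD' E hE => by
    rw [add_assoc]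
    exact hD _ (hD' _ hE)
  neg_mem' := fun {D} hD E hE => by
    have h := (hD _ hE.neg).neg
    rwa [neg_add, neg_neg] at h

/-- The affine class group `ACl A`: Weil divisors modulo affine trivial divisors. -/
abbrev ACl (A : Type u) [CommRing A] [IsDomain A] [IsNoetherianRing A]
    [IsIntegrallyClosed A] : Type u :=
  WeilDivisor A ⧸ affineTrivialSubgroup A

/-- The class of a divisor in the affine class group. -/
def ACl.mk {A : Type u} [CommRing A] [IsDomain A] [IsNoetherianRing A]
    [IsIntegrallyClosed A] (D : WeilDivisor A) : ACl A :=
  QuotientAddGroup.mk D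

/-- The preimage of the prime divisor `V(p)` of `Spec A` in `Spec A[T]`: the cylinder
`V(p A[T])`, which is again a prime divisor. -/
def cylinder {A : Type u} [CommRing A] [IsNoetherianRing A]
    (P : PrimeDivisor A) : PrimeDivisor (Polynomial A) :=
  ⟨⟨P.1.asIdeal.map Polynomial.C, inferInstance⟩, by
    have hc : (P.1.asIdeal.map Polynomial.C).comap Polynomial.C = P.1.asIdeal := by
      ext x
      rw [Ideal.mem_comap, Ideal.mem_map_C_iff]
      refine ⟨fun h => by simpa using h 0, fun h n => ?_⟩
      rw [Polynomial.coeff_C]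
      split_ifs
      · exact h
      · exact zero_mem _
    have : (P.1.asIdeal.map Polynomial.C).LiesOver P.1.asIdeal := ⟨hc.symm⟩
    have h := Ideal.height_eq_height_add_of_liesOver_of_hasGoingDown P.1.asIdeal
      (P := P.1.asIdeal.map (Polynomial.C : A →+* Polynomial A))
    simpa [P.2] using h⟩

/-- The pull-back of divisors along `Spec A[T] → Spec A`. The fibre over `V(p)` is the integral
scheme `Spec (A/p)[T]`, so each prime divisor pulls back to its cylinder with multiplicity one. -/
def pullback {A : Type u} [CommRing A] [IsNoetherianRing A] :
    WeilDivisor A →+ WeilDivisor (Polynomial A) :=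
  Finsupp.mapDomain.addMonoidHom cylinder

end AffineClassGroup

end

/-!
The proof rests on a comparison of coaffineness on `Spec A` and on `Spec A[T]`: a divisor `D` is
coaffine if and only if its pull-back is (`Coaffine.pullback` and `Coaffine.of_pullback`). Since
every divisor of `Spec A[T]` is linearly equivalent to a pull-back
(`exists_linearlyEquivalent_pullback`) and all the properties in question are invariant under linear
equivalence, strongly coaffine and affine trivial divisors then correspond to each other, which
gives the isomorphism. If all hypersurface complements in `Spec A` are affine, all divisors of
`Spec A` are coaffine, hence so are all divisors of `Spec A[T]`, and every hypersurface is the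
support of an effective divisor.

Coaffineness descends from the pull-back of `D` to `D` by restriction to the zero section
(`HasAffineComplement.of_pullback`). In the other direction, an effective divisor linearly
equivalent to the pull-back of `D` is the zero divisor of a section `s` of the pull-back, i.e. of a
polynomial `∑ s_i T ^ i` whose coefficients are sections of `D`. The complement of the zeros of each
`s_i` is affine by assumption. On the complement `Y` of the zeros of `s` the functions
`f_i = s_i / s` are regular and satisfy `∑ f_i T ^ i = 1`. The locus in `Y` where `f_i` does not
vanish is an affine scheme, namely the locus where `s / s_i` does not vanish in the cylinder over
the complement of the zeros of `s_i`. So `Y` is affine (`hasAffineComplement_of_coeff`).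

The argument is carried out in the fields of fractions. The complement of `V(J)` in the spectrum of
a domain is affine if and only if `J` generates the unit ideal in the ring of regular functions on
this complement (`hasAffineComplement_of_map_eq_top`, `map_eq_top_of_hasAffineComplement`). On a
normal noetherian domain the regular functions are those without poles
(`div_mem_regularFunctions_iff`), because such a domain is the intersection of its localizations at
the primes of height one (`dvd_of_ord_le`). The orders of a polynomial along prime divisors of
`Spec A[T]` are controlled by Gauss's lemma (`ord_cylinder_le`).
-/

noncomputable section

namespace AffineClassGroup

open CategoryTheory TopologicalSpace Opposite

/-! ### Affine open subsets of the spectrum of a domain -/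

/-- An element of `A`, as a section of the structure sheaf over an open subset of `Spec A`. -/
def toSection {A : Type u} [CommRing A] (U : (Spec (CommRingCat.of A)).Opens) :
    A →+* Γ(Spec (CommRingCat.of A), U) :=
  ((Scheme.ΓSpecIso (CommRingCat.of A)).inv ≫
    (Spec (CommRingCat.of A)).presheaf.map (homOfLE le_top).op).hom

theorem basicOpen_toSection {A : Type u} [CommRing A] (U : (Spec (CommRingCat.of A)).Opens)
    (a : A) :
    (Spec (CommRingCat.of A)).basicOpen (toSection U a) = U ⊓ PrimeSpectrum.basicOpen a := by
  have h := (Spec (CommRingCat.of A)).basicOpen_res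
    ((Scheme.ΓSpecIso (CommRingCat.of A)).inv a) (homOfLE (le_top (a := U))).op
  refine h.trans ?_
  rw [basicOpen_eq_of_affine]

theorem toSection_injective {A : Type u} [CommRing A] [IsDomain A]
    {U : (Spec (CommRingCat.of A)).Opens} (hU : (⊥ : PrimeSpectrum A) ∈ U) :
    Function.Injective (toSection U) := by
  rw [injective_iff_map_eq_zero]
  intro a ha
  have h := basicOpen_toSection U a
  rw [ha, Scheme.basicOpen_zero] at h
  by_contra hne
  have : (⊥ : PrimeSpectrum A) ∈ (⊥ : (Spec (CommRingCat.of A)).Opens) := by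
    rw [h]
    exact ⟨hU, hne⟩
  exact this

/-- A section over `V = D(d)` is a fraction with a power of `d` as denominator. -/
theorem exists_pow_mul_eq_toSection {A : Type u} [CommRing A] {d : A}
    (V : (Spec (CommRingCat.of A)).Opens) (hV : V = PrimeSpectrum.basicOpen d)
    (β : Γ(Spec (CommRingCat.of A), V)) :
    ∃ (n : ℕ) (e : A), toSection V (d ^ n) * β = toSection V e := by
  subst hV
  obtain ⟨n, e, h⟩ := @IsLocalization.Away.surj A _
    ((Spec.structureSheaf A).obj.obj (op (PrimeSpectrum.basicOpen d))) _
    (StructureSheaf.openAlgebra A (op (PrimeSpectrum.basicOpen d))) d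
    (StructureSheaf.IsLocalization.to_basicOpen A d) β
  refine ⟨n, e, ?_⟩
  rw [map_pow, mul_comm]
  exact h

/-- A fraction `x / y` that has a denominator outside `p` for each point `p` of `U` is a section of
the structure sheaf over `U`. -/
theorem exists_section_mul_eq {A : Type u} [CommRing A] [IsDomain A]
    (U : (Spec (CommRingCat.of A)).Opens) {x y : A} (hy : y ≠ 0)
    (h : ∀ p : PrimeSpectrum A, p ∈ U → ∃ d e : A, d ∉ p.asIdeal ∧ d * x = y * e) :
    ∃ β : Γ(Spec (CommRingCat.of A), U), toSection U y * β = toSection U x := by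
  choose d e hd he using h
  let β : StructureSheaf.sectionsSubalgebra (R := A) A U :=
    ⟨fun p => LocalizedModule.mk (e p.1 p.2) ⟨d p.1 p.2, hd p.1 p.2⟩, by
      intro p
      refine ⟨PrimeSpectrum.basicOpen (d p.1 p.2) ⊓ U, ⟨hd p.1 p.2, p.2⟩,
        homOfLE inf_le_right, e p.1 p.2, d p.1 p.2, fun q => ⟨q.2.1, ?_⟩⟩
      refine LocalizedModule.mk_eq.mpr ⟨1, ?_⟩
      have h1 := he p.1 p.2
      have h2 := he q.1 q.2.2
      simp only [Submonoid.smul_def, one_smul, smul_eq_mul]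
      apply mul_left_cancel₀ hy
      linear_combination (d p.1 p.2) * (-h2) + (d q.1 q.2.2) * h1⟩
  refine ⟨β, Subtype.ext (funext fun p => ?_)⟩
  have hloc : ∀ (q : PrimeSpectrum A) (d e : A) (hd : d ∈ q.asIdeal.primeCompl), d * x = y * e →
      (LocalizedModule.mk (y * e) (⟨d, hd⟩ * 1) : LocalizedModule q.asIdeal.primeCompl A) =
        LocalizedModule.mk x 1 := by
    intro q d e hd he
    refine LocalizedModule.mk_eq.mpr ⟨1, ?_⟩
    simp [Submonoid.smul_def, he]
  exact hloc _ _ _ _ (he p.1 p.2)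

/-- The subring of the field of fractions `K` of `A` formed by the functions that are regular on
the complement of `V(J)` in `Spec A`: those `b` for which every element of `J` has a power that is
a denominator of `b`. -/
def regularFunctions {A : Type*} [CommRing A] (K : Type*) [Field K] [Algebra A K] (J : Ideal A) :
    Subalgebra A K where
  carrier := {b | ∀ d ∈ J, ∃ (n : ℕ) (e : A), algebraMap A K (d ^ n) * b = algebraMap A K e}
  mul_mem' {b c} hb hc d hd := by
    obtain ⟨n, e, h⟩ := hb d hd
    obtain ⟨m, f, h'⟩ := hc d hd
    exact ⟨n + m, e * f, by rw [map_mul, ← h, ← h', pow_add, map_mul]; ring⟩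
  add_mem' {b c} hb hc d hd := by
    obtain ⟨n, e, h⟩ := hb d hd
    obtain ⟨m, f, h'⟩ := hc d hd
    exact ⟨n + m, d ^ m * e + d ^ n * f, by
      rw [map_add, map_mul, map_mul, ← h, ← h', pow_add, map_mul]; ring⟩
  algebraMap_mem' a d _ := ⟨0, a, by simp⟩

/-- If `J` generates the unit ideal in the ring of functions on the complement of `V(J)`, then this
complement is affine, being covered by the affine schemes `D(d)` for `d ∈ J`. -/
theorem hasAffineComplement_of_map_eq_top {A : Type u} [CommRing A] [IsDomain A] (K : Type*)
    [Field K] [Algebra A K] [IsFractionRing A K] {J : Ideal A} (hJ : J ≠ ⊥)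
    (h : J.map (algebraMap A (regularFunctions K J)) = ⊤) :
    HasAffineComplement (PrimeSpectrum.zeroLocus (J : Set A)) := by
  let U : (Spec (CommRingCat.of A)).Opens :=
    ⟨(PrimeSpectrum.zeroLocus (J : Set A))ᶜ, (PrimeSpectrum.isClosed_zeroLocus _).isOpen_compl⟩
  have hU : (⊥ : PrimeSpectrum A) ∈ U := fun hle => hJ (le_bot_iff.mp hle)
  have hinj : Function.Injective (toSection U) := toSection_injective hU
  have : Nonempty U := ⟨⟨_, hU⟩⟩
  have hreg : ∀ b : regularFunctions K J, ∃ x y : A, y ≠ 0 ∧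
      algebraMap A K y * b = algebraMap A K x ∧
      ∃ β : Γ(Spec (CommRingCat.of A), U), toSection U y * β = toSection U x := by
    rintro ⟨b, hb⟩
    obtain ⟨x, y, hy, rfl⟩ := IsFractionRing.div_surjective (A := A) b
    have hy0 : y ≠ 0 := nonZeroDivisors.ne_zero hy
    have hyK : algebraMap A K y ≠ 0 := by simpa using hy0
    refine ⟨x, y, hy0, by field_simp, exists_section_mul_eq U hy0 fun p hp => ?_⟩
    obtain ⟨d, hdJ, hdp⟩ := Set.not_subset.mp (show ¬ (J : Set A) ⊆ p.asIdeal from hp)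
    obtain ⟨n, e, he⟩ := hb d hdJ
    refine ⟨d ^ n, e, fun hmem => hdp (p.isPrime.mem_of_pow_mem n hmem), ?_⟩
    apply IsFractionRing.injective A K
    rw [map_mul, map_mul, ← he]
    field_simp
  -- An equation over the subring of `K` is cleared of denominators and read in the ring of
  -- sections, which is a domain.
  have key : ∀ b ∈ J.map (algebraMap A (regularFunctions K J)), ∃ x y : A, y ≠ 0 ∧
      algebraMap A K y * b = algebraMap A K x ∧
      ∃ β ∈ J.map (toSection U), toSection U y * β = toSection U x := by
    intro b hb
    refine Submodule.span_induction ?_ ?_ ?_ ?_ hb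
    · rintro _ ⟨a, ha, rfl⟩
      exact ⟨a, 1, one_ne_zero, by simp, _, Ideal.mem_map_of_mem _ ha, by simp⟩
    · exact ⟨0, 1, one_ne_zero, by simp, 0, zero_mem _, by simp⟩
    · rintro b c - - ⟨x, y, hy, hb, β, hβ, h1⟩ ⟨x', y', hy', hc, γ, hγ, h2⟩
      refine ⟨x * y' + x' * y, y * y', mul_ne_zero hy hy', ?_, β + γ, add_mem hβ hγ, ?_⟩
      · simp only [map_add, map_mul, ← hb, ← hc, Subalgebra.coe_add]; ring
      · simp only [map_add, map_mul, ← h1, ← h2]; ring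
    · rintro c b - ⟨x, y, hy, hb, β, hβ, h1⟩
      obtain ⟨x', y', hy', hc, γ, h2⟩ := hreg c
      refine ⟨x' * x, y' * y, mul_ne_zero hy' hy, ?_, γ * β, Ideal.mul_mem_left _ _ hβ, ?_⟩
      · simp only [map_mul, ← hb, ← hc, smul_eq_mul, Subalgebra.coe_mul]; ring
      · simp only [map_mul, ← h1, ← h2]; ring
  refine ⟨U, rfl, isAffineOpen_of_isAffineOpen_basicOpen U (toSection U '' J) ?_ ?_⟩
  · obtain ⟨x, y, hy, hxy, β, hβ, h1⟩ := key 1 (h ▸ Submodule.mem_top)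
    have hxy' : y = x := IsFractionRing.injective A K (by simpa using hxy)
    subst hxy'
    have hβ1 : β = 1 := by
      refine mul_left_cancel₀ (a := toSection U y) ?_ (by rw [h1, mul_one])
      rwa [Ne, map_eq_zero_iff _ hinj]
    rw [← Ideal.map, Ideal.eq_top_iff_one]
    rwa [hβ1] at hβ
  · rintro _ ⟨d, hd, rfl⟩
    have hle : (PrimeSpectrum.basicOpen d : Opens (PrimeSpectrum A)) ≤ U :=
      fun p hp hle => hp (hle hd)
    rw [basicOpen_toSection]
    have heq : U ⊓ PrimeSpectrum.basicOpen d = PrimeSpectrum.basicOpen d := inf_eq_right.mpr hle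
    rw [heq]
    exact IsAffineOpen.Spec_basicOpen (R := CommRingCat.of A) d

/-- On an affine scheme, functions without common zero generate the unit ideal. -/
theorem map_eq_top_of_hasAffineComplement {A : Type u} [CommRing A] [IsDomain A] (K : Type*)
    [Field K] [Algebra A K] [IsFractionRing A K] {J : Ideal A} (hJ : J ≠ ⊥)
    (h : HasAffineComplement (PrimeSpectrum.zeroLocus (J : Set A))) :
    J.map (algebraMap A (regularFunctions K J)) = ⊤ := by
  obtain ⟨U, hU, hUa⟩ := h
  have hUmem : ∀ p : PrimeSpectrum A, p ∈ U ↔ ¬ (J : Set A) ⊆ p.asIdeal := fun p =>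
    Set.ext_iff.mp hU p
  have hU : (⊥ : PrimeSpectrum A) ∈ U := (hUmem _).mpr fun hle => hJ (le_bot_iff.mp hle)
  have hinj : Function.Injective (toSection U) := toSection_injective hU
  have : Nonempty U := ⟨⟨_, hU⟩⟩
  have hspan : J.map (toSection U) = ⊤ := by
    refine (hUa.self_le_iSup_basicOpen_iff (s := toSection U '' J)).mp ?_
    intro p hp
    obtain ⟨d, hdJ, hdp⟩ := Set.not_subset.mp ((hUmem p).mp hp)
    rw [Opens.mem_iSup]
    refine ⟨⟨_, d, hdJ, rfl⟩, ?_⟩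
    rw [basicOpen_toSection]
    exact ⟨hp, hdp⟩
  have hpow : ∀ d ∈ J, d ≠ 0 → ∀ β : Γ(Spec (CommRingCat.of A), U), ∃ (n : ℕ) (e : A),
      toSection U (d ^ n) * β = toSection U e := by
    intro d hd hd0 β
    have hle : (PrimeSpectrum.basicOpen d : (Spec (CommRingCat.of A)).Opens) ≤ U :=
      fun p hp => (hUmem p).mpr fun hle => hp (hle hd)
    obtain ⟨V, hV⟩ : ∃ V : (Spec (CommRingCat.of A)).Opens, V = PrimeSpectrum.basicOpen d :=
      ⟨_, rfl⟩
    rw [← hV] at hle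
    have : Nonempty V := ⟨⟨(⊥ : PrimeSpectrum A), by rw [hV]; exact hd0⟩⟩
    obtain ⟨n, e, he⟩ := exists_pow_mul_eq_toSection V hV
      ((Spec (CommRingCat.of A)).presheaf.map (homOfLE hle).op β)
    refine ⟨n, e, map_injective_of_isIntegral (Spec (CommRingCat.of A)) (homOfLE hle) ?_⟩
    rw [map_mul]
    exact he
  obtain ⟨f, hfJ, hf0⟩ := Submodule.exists_mem_ne_zero_of_ne_bot hJ
  have hreg : ∀ β : Γ(Spec (CommRingCat.of A), U), ∃ b : regularFunctions K J, ∃ x y : A, y ≠ 0 ∧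
      algebraMap A K y * b = algebraMap A K x ∧ toSection U y * β = toSection U x := by
    intro β
    obtain ⟨n, x, hx⟩ := hpow f hfJ hf0 β
    have hfn : f ^ n ≠ 0 := pow_ne_zero n hf0
    have hfK : algebraMap A K (f ^ n) ≠ 0 := by simpa using fun h => absurd h hf0
    refine ⟨⟨algebraMap A K x / algebraMap A K (f ^ n), fun d hd => ?_⟩, x, f ^ n, hfn,
      by field_simp, hx⟩
    rcases eq_or_ne d 0 with rfl | hd0
    · exact ⟨1, 0, by simp⟩
    obtain ⟨m, e, he⟩ := hpow d hd hd0 β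
    refine ⟨m, e, ?_⟩
    have : d ^ m * x = f ^ n * e := by
      apply hinj
      rw [map_mul, map_mul, ← hx, ← he]
      ring
    rw [← mul_div_assoc, ← map_mul, this, map_mul]
    field_simp
  -- Sections over `U` and regular functions in `K` are compared as fractions of elements of `A`.
  have key : ∀ β ∈ J.map (toSection U), ∃ b ∈ J.map (algebraMap A (regularFunctions K J)),
      ∃ x y : A, y ≠ 0 ∧
      algebraMap A K y * b = algebraMap A K x ∧ toSection U y * β = toSection U x := by
    intro β hβ
    refine Submodule.span_induction ?_ ?_ ?_ ?_ hβ
    · rintro _ ⟨a, ha, rfl⟩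
      exact ⟨_, Ideal.mem_map_of_mem _ ha, a, 1, one_ne_zero, by simp, by simp⟩
    · exact ⟨0, zero_mem _, 0, 1, one_ne_zero, by simp, by simp⟩
    · rintro β γ - - ⟨b, hb, x, y, hy, h1, h2⟩ ⟨c, hc, x', y', hy', h1', h2'⟩
      refine ⟨b + c, add_mem hb hc, x * y' + x' * y, y * y', mul_ne_zero hy hy', ?_, ?_⟩
      · simp only [map_add, map_mul, ← h1, ← h1', Subalgebra.coe_add]; ring
      · simp only [map_add, map_mul, ← h2, ← h2']; ring
    · rintro γ β - ⟨b, hb, x, y, hy, h1, h2⟩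
      obtain ⟨c, x', y', hy', h1', h2'⟩ := hreg γ
      refine ⟨c * b, Ideal.mul_mem_left _ _ hb, x' * x, y' * y, mul_ne_zero hy' hy, ?_, ?_⟩
      · simp only [map_mul, ← h1, ← h1', Subalgebra.coe_mul]; ring
      · simp only [map_mul, ← h2, ← h2', smul_eq_mul]; ring
  obtain ⟨b, hb, x, y, hy, h1, h2⟩ := key 1 (hspan ▸ Submodule.mem_top)
  have hxy : y = x := hinj (by simpa using h2)
  subst hxy
  have hb1 : b = 1 := by
    have hyK : algebraMap A K y ≠ 0 := by simpa using hy
    exact Subtype.ext (mul_left_cancel₀ hyK (by rw [h1]; simp))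
  rw [Ideal.eq_top_iff_one]
  rwa [hb1] at hb

/-! ### Supports of divisors -/

theorem PrimeDivisor.eq_of_le {A : Type u} [CommRing A] {P Q : PrimeDivisor A}
    (h : P.1.asIdeal ≤ Q.1.asIdeal) : P = Q := by
  have : P.1.asIdeal.FiniteHeight :=
    Ideal.finiteHeight_iff_lt.mpr (.inr (by rw [P.2]; exact ENat.one_lt_top))
  exact Subtype.ext (PrimeSpectrum.ext (Ideal.eq_of_le_of_height_le _ h (by rw [P.2, Q.2])))

theorem PrimeDivisor.asIdeal_ne_bot {A : Type u} [CommRing A] [IsDomain A] (P : PrimeDivisor A) :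
    P.1.asIdeal ≠ ⊥ := by
  intro h
  have := P.2
  rw [Ideal.height_eq_zero_iff_eq_bot.mpr h] at this
  exact zero_ne_one this

/-- The ideal of the functions that vanish on the support of a divisor. -/
def supportIdeal {A : Type u} [CommRing A] (E : WeilDivisor A) : Ideal A :=
  E.support.inf fun P => P.1.asIdeal

theorem mem_supportIdeal {A : Type u} [CommRing A] {E : WeilDivisor A} {a : A} :
    a ∈ supportIdeal E ↔ ∀ P, E P ≠ 0 → a ∈ P.1.asIdeal := by
  simp [supportIdeal, Submodule.mem_finsetInf]

theorem supportIdeal_le_iff {A : Type u} [CommRing A] {E : WeilDivisor A} (p : PrimeSpectrum A) :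
    supportIdeal E ≤ p.asIdeal ↔ ∃ P, E P ≠ 0 ∧ P.1.asIdeal ≤ p.asIdeal := by
  rw [supportIdeal, Ideal.IsPrime.inf_le' p.isPrime]
  simp

theorem zeroLocus_supportIdeal {A : Type u} [CommRing A] (E : WeilDivisor A) :
    PrimeSpectrum.zeroLocus (supportIdeal E : Set A) = supp E := by
  ext p
  rw [PrimeSpectrum.mem_zeroLocus, SetLike.coe_subset_coe, supportIdeal_le_iff]
  simp [supp]

theorem supportIdeal_ne_bot {A : Type u} [CommRing A] [IsDomain A] (E : WeilDivisor A) :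
    supportIdeal E ≠ ⊥ := by
  intro h
  obtain ⟨P, -, hP⟩ := (supportIdeal_le_iff (⊥ : PrimeSpectrum A)).mp h.le
  exact P.asIdeal_ne_bot (le_bot_iff.mp hP)

theorem hasAffineComplement_supp_iff {A : Type u} [CommRing A] [IsDomain A] (K : Type*)
    [Field K] [Algebra A K] [IsFractionRing A K] (E : WeilDivisor A) :
    HasAffineComplement (supp E) ↔
      (supportIdeal E).map (algebraMap A (regularFunctions K (supportIdeal E))) = ⊤ := by
  rw [← zeroLocus_supportIdeal]
  exact ⟨map_eq_top_of_hasAffineComplement K (supportIdeal_ne_bot E),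
    hasAffineComplement_of_map_eq_top K (supportIdeal_ne_bot E)⟩

/-! ### The order of vanishing along a prime divisor -/

section Order

variable {A : Type u} [CommRing A] [IsDomain A] [IsNoetherianRing A] [IsIntegrallyClosed A]
  (P : PrimeDivisor A)

theorem addVal_algebraMap {a : A} (ha : a ≠ 0) :
    IsDiscreteValuationRing.addVal (Localization.AtPrime P.1.asIdeal)
      (algebraMap A (Localization.AtPrime P.1.asIdeal) a) = ((ord P a).toNat : ℕ∞) := by
  have hinj := IsLocalization.injective (Localization.AtPrime P.1.asIdeal)
    P.1.asIdeal.primeCompl_le_nonZeroDivisors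
  have h : IsDiscreteValuationRing.addVal (Localization.AtPrime P.1.asIdeal)
      (algebraMap A (Localization.AtPrime P.1.asIdeal) a) ≠ ⊤ := by
    rw [Ne, IsDiscreteValuationRing.addVal_eq_top_iff]
    exact fun h => ha (hinj (h.trans (map_zero _).symm))
  rw [ord, Int.toNat_natCast, ENat.natCast_toNat h]

theorem ord_nonneg (a : A) : 0 ≤ ord P a := Int.natCast_nonneg _

theorem ord_mul {a b : A} (ha : a ≠ 0) (hb : b ≠ 0) : ord P (a * b) = ord P a + ord P b := by
  have h := addVal_algebraMap P (mul_ne_zero ha hb)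
  rw [map_mul, IsDiscreteValuationRing.addVal_mul, addVal_algebraMap P ha,
    addVal_algebraMap P hb] at h
  have h' : (ord P a).toNat + (ord P b).toNat = (ord P (a * b)).toNat := by exact_mod_cast h
  have := ord_nonneg P a
  have := ord_nonneg P b
  have := ord_nonneg P (a * b)
  omega

theorem ord_one : ord P (1 : A) = 0 := by
  have := ord_mul P (one_ne_zero (α := A)) one_ne_zero
  rw [mul_one] at this
  omega

theorem ord_pow {a : A} (ha : a ≠ 0) (n : ℕ) : ord P (a ^ n) = n * ord P a := by
  induction n with
  | zero => simp [ord_one]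
  | succ n ih => rw [pow_succ, ord_mul P (pow_ne_zero n ha) ha, ih]; push_cast; ring

/-- Divisibility in the local ring `A_P`, expressed in `A`. -/
theorem ord_le_ord_iff {a b : A} (ha : a ≠ 0) (hb : b ≠ 0) :
    ord P a ≤ ord P b ↔ ∃ u ∉ P.1.asIdeal, a ∣ u * b := by
  have hinj := IsLocalization.injective (Localization.AtPrime P.1.asIdeal)
    P.1.asIdeal.primeCompl_le_nonZeroDivisors
  have h1 : ord P a ≤ ord P b ↔ algebraMap A (Localization.AtPrime P.1.asIdeal) a ∣
      algebraMap A (Localization.AtPrime P.1.asIdeal) b := by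
    rw [← IsDiscreteValuationRing.addVal_le_iff_dvd, addVal_algebraMap P ha,
      addVal_algebraMap P hb, Nat.cast_le]
    have := ord_nonneg P a
    have := ord_nonneg P b
    omega
  rw [h1]
  constructor
  · rintro ⟨c, hc⟩
    obtain ⟨x, s, rfl⟩ := IsLocalization.exists_mk'_eq P.1.asIdeal.primeCompl c
    refine ⟨s, s.2, x, hinj ?_⟩
    rw [map_mul, map_mul, hc, mul_left_comm, IsLocalization.mk'_spec']
  · rintro ⟨u, hu, hdvd⟩
    have hunit := IsLocalization.map_units (Localization.AtPrime P.1.asIdeal)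
      (⟨u, hu⟩ : P.1.asIdeal.primeCompl)
    have := map_dvd (algebraMap A (Localization.AtPrime P.1.asIdeal)) hdvd
    rw [map_mul] at this
    exact hunit.dvd_mul_left.mp this

theorem ord_eq_zero_iff {a : A} (ha : a ≠ 0) : ord P a = 0 ↔ a ∉ P.1.asIdeal := by
  have h := ord_le_ord_iff P ha one_ne_zero
  rw [ord_one] at h
  have := ord_nonneg P a
  rw [show ord P a = 0 ↔ ord P a ≤ 0 by omega, h]
  constructor
  · rintro ⟨u, hu, hau⟩ haP
    rw [mul_one] at hau
    exact hu (P.1.asIdeal.mem_of_dvd hau haP)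
  · exact fun haP => ⟨a, haP, by simp⟩

theorem ord_pos_iff {a : A} (ha : a ≠ 0) : 0 < ord P a ↔ a ∈ P.1.asIdeal := by
  have := ord_nonneg P a
  have := ord_eq_zero_iff P ha
  by_cases h : a ∈ P.1.asIdeal <;> simp [h] at this ⊢ <;> omega

theorem exists_ord_eq_one : ∃ π : A, π ≠ 0 ∧ ord P π = 1 := by
  obtain ⟨ϖ, hϖ⟩ := IsDiscreteValuationRing.exists_irreducible (Localization.AtPrime P.1.asIdeal)
  obtain ⟨x, s, rfl⟩ := IsLocalization.exists_mk'_eq P.1.asIdeal.primeCompl ϖ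
  have hs := IsLocalization.map_units (Localization.AtPrime P.1.asIdeal) s
  have hx : x ≠ 0 := by
    rintro rfl
    exact hϖ.ne_zero (IsLocalization.mk'_zero s)
  refine ⟨x, hx, ?_⟩
  have h := addVal_algebraMap P hx
  rw [← IsLocalization.mk'_spec _ x s, IsDiscreteValuationRing.addVal_mul,
    IsDiscreteValuationRing.addVal_uniformizer hϖ,
    IsDiscreteValuationRing.addVal_eq_zero_iff.mpr hs, add_zero] at h
  have h' : 1 = (ord P x).toNat := by exact_mod_cast h
  omega

/-- An element that generates the prime ideal `P` in the local ring `A_P` has order one. -/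
theorem ord_eq_one {π : A} (hπ : π ∈ P.1.asIdeal) (hπ0 : π ≠ 0)
    (h : ∀ p ∈ P.1.asIdeal, ∃ u ∉ P.1.asIdeal, π ∣ u * p) : ord P π = 1 := by
  obtain ⟨ϖ, hϖ0, hϖ⟩ := exists_ord_eq_one P
  have h1 := (ord_pos_iff P hπ0).mpr hπ
  have h2 := (ord_le_ord_iff P hπ0 hϖ0).mpr (h ϖ ((ord_pos_iff P hϖ0).mp (by omega)))
  omega

theorem le_ord_of_mem_pow {a : A} (ha : a ≠ 0) {n : ℕ} (h : a ∈ P.1.asIdeal ^ n) :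
    (n : ℤ) ≤ ord P a := by
  obtain ⟨ϖ, hϖ0, hϖ⟩ := exists_ord_eq_one P
  suffices ∃ u ∉ P.1.asIdeal, ϖ ^ n ∣ u * a by
    have := (ord_le_ord_iff P (pow_ne_zero n hϖ0) ha).mpr this
    rwa [ord_pow P hϖ0, hϖ, mul_one] at this
  clear ha
  induction n generalizing a with
  | zero => exact ⟨1, P.1.asIdeal.one_notMem, by simp⟩
  | succ n ih =>
    rw [pow_succ] at h
    refine Submodule.mul_induction_on h ?_ ?_
    · intro x hx y hy
      obtain ⟨u, hu, hdvd⟩ := ih hx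
      obtain ⟨v, hv, hdvd'⟩ : ∃ v ∉ P.1.asIdeal, ϖ ∣ v * y := by
        rcases eq_or_ne y 0 with rfl | hy0
        · exact ⟨1, P.1.asIdeal.one_notMem, by simp⟩
        · have := (ord_pos_iff P hy0).mpr hy
          exact (ord_le_ord_iff P hϖ0 hy0).mp (by omega)
      refine ⟨u * v, P.1.asIdeal.primeCompl.mul_mem hu hv, ?_⟩
      rw [pow_succ, mul_mul_mul_comm]
      exact mul_dvd_mul hdvd hdvd'
    · rintro x y ⟨u, hu, hx⟩ ⟨v, hv, hy⟩
      refine ⟨u * v, P.1.asIdeal.primeCompl.mul_mem hu hv, ?_⟩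
      rw [mul_add]
      exact dvd_add (by rw [mul_right_comm]; exact hx.mul_right v)
        (by rw [mul_assoc]; exact hy.mul_left u)

/-- In a normal noetherian domain, a conductor ideal `{s | b ∣ s * x}` that is prime has height
one: either `x / b` maps the ideal into itself, and is then integral, or the ideal becomes
principal after localization. -/
theorem height_eq_one_of_isPrime {q : Ideal A} [hq : q.IsPrime] {b x : A} (hb : b ≠ 0)
    (h : ∀ s, s ∈ q ↔ b ∣ s * x) : q.height = 1 := by
  have hbq : b ∈ q := (h b).mpr (dvd_mul_right b x)
  have hq0 : q ≠ ⊥ := fun h => hb (by rwa [h] at hbq)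
  have hx : ¬ b ∣ x := fun hx => hq.ne_top ((Ideal.eq_top_iff_one q).mpr ((h 1).mpr (by simpa)))
  choose! r hr using fun s hs => (h s).mp hs
  obtain ⟨t, ht, htr⟩ : ∃ t ∈ q, r t ∉ q := by
    by_contra! hall
    apply hx
    have hint : IsIntegral A
        (algebraMap A (FractionRing A) x / algebraMap A (FractionRing A) b) := by
      have hbK : algebraMap A (FractionRing A) b ≠ 0 := by simpa using hb
      refine isIntegral_of_smul_mem_submodule 
        (Submodule.map (Algebra.linearMap A (FractionRing A)) q)
        ?_ ((IsNoetherian.noetherian q).map _) _ ?_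
      · rw [Submodule.ne_bot_iff]
        exact ⟨_, ⟨b, hbq, rfl⟩, hbK⟩
      · rintro _ ⟨s, hs, rfl⟩
        refine ⟨r s, hall s hs, ?_⟩
        have := congrArg (algebraMap A (FractionRing A)) (hr s hs)
        rw [map_mul, map_mul] at this
        rw [Algebra.linearMap_apply, Algebra.linearMap_apply, smul_eq_mul]
        field_simp
        rw [mul_comm, ← this, mul_comm]
    obtain ⟨c, hc⟩ := IsIntegrallyClosed.isIntegral_iff.mp hint
    refine ⟨c, IsFractionRing.injective A (FractionRing A) ?_⟩
    have : algebraMap A (FractionRing A) b ≠ 0 := by simpa using hb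
    rw [map_mul, hc]
    field_simp
  have hdvd : ∀ s ∈ q, r t * s = t * r s := by
    intro s hs
    apply mul_left_cancel₀ hb
    linear_combination (-s) * hr t ht + t * hr s hs
  have hmin : q ∈ (Ideal.span {t}).minimalPrimes := by
    refine ⟨⟨hq, by simpa [Ideal.span_le] using ht⟩, ?_⟩
    rintro p ⟨hp, htp⟩ hpq s hs
    have : r t * s ∈ p := by
      rw [hdvd s hs]
      exact p.mul_mem_right _ (htp (Ideal.mem_span_singleton_self t))
    exact (hp.mem_or_mem this).resolve_left fun h => htr (hpq h)
  refine le_antisymm ?_ ?_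
  · exact Ideal.height_le_one_of_isPrincipal_of_mem_minimalPrimes _ _ hmin
  · rw [Order.one_le_iff_ne_zero, Ne, Ideal.height_eq_zero_iff_eq_bot]
    exact hq0

/-- A normal noetherian domain is the intersection of its localizations at the primes of height
one. -/
theorem dvd_of_ord_le {a b : A} (ha : a ≠ 0) (hb : b ≠ 0)
    (h : ∀ P : PrimeDivisor A, ord P b ≤ ord P a) : b ∣ a := by
  by_contra hndvd
  -- The conductor of `a / b` lies in an associated prime of `A / (b)`.
  have ha' : Ideal.Quotient.mk (Ideal.span {b}) a ≠ 0 := by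
    rwa [Ne, Ideal.Quotient.eq_zero_iff_mem, Ideal.mem_span_singleton]
  obtain ⟨q, hqass, hq⟩ := exists_le_isAssociatedPrime_of_isNoetherianRing A _ ha'
  obtain ⟨hqp, x, hx⟩ := isAssociatedPrime_iff.mp hqass
  obtain ⟨x, rfl⟩ := Ideal.Quotient.mk_surjective x
  have hmem : ∀ y s : A, s ∈ (⊥ : Submodule A (A ⧸ Ideal.span {b})).colon
      {Ideal.Quotient.mk (Ideal.span {b}) y} ↔ b ∣ s * y := by
    intro y s
    rw [Submodule.mem_colon_singleton, Submodule.mem_bot, ← Ideal.mem_span_singleton,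
      ← Ideal.Quotient.eq_zero_iff_mem, map_mul]
    rfl
  have hheight := height_eq_one_of_isPrime (x := x) hb fun s => hx ▸ hmem x s
  obtain ⟨u, hu, hdvd⟩ := (ord_le_ord_iff ⟨⟨q, hqp⟩, hheight⟩ hb ha).mp (h _)
  exact hu (hq ((hmem a u).mpr hdvd))

/-! ### Principal divisors and regular functions -/

theorem div_apply (a : A) : div a P = ord P a := rfl

theorem div_mul {a b : A} (ha : a ≠ 0) (hb : b ≠ 0) : div (a * b) = div a + div b :=
  Finsupp.ext fun P => ord_mul P ha hb

theorem div_one : div (1 : A) = 0 := Finsupp.ext fun P => ord_one P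

/-- On a normal scheme a rational function is regular where it has no poles. -/
theorem div_mem_regularFunctions_iff (K : Type*) [Field K] [Algebra A K] [IsFractionRing A K]
    {E : WeilDivisor A} {x y : A} (hx : x ≠ 0) (hy : y ≠ 0) :
    algebraMap A K x / algebraMap A K y ∈ regularFunctions K (supportIdeal E) ↔
      ∀ P, E P = 0 → ord P y ≤ ord P x := by
  have hyK : algebraMap A K y ≠ 0 := by simpa using hy
  have hiff : algebraMap A K x / algebraMap A K y ∈ regularFunctions K (supportIdeal E) ↔
      ∀ d ∈ supportIdeal E, ∃ n : ℕ, y ∣ d ^ n * x := by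
    refine forall₂_congr fun d _ => exists_congr fun n => exists_congr fun e => ?_
    rw [← mul_div_assoc, div_eq_iff hyK, ← map_mul, ← map_mul,
      (IsFractionRing.injective A K).eq_iff, mul_comm e]
  rw [hiff]
  constructor
  · intro h P hP
    obtain ⟨d, hd, hdP⟩ := SetLike.not_le_iff_exists.mp fun hle => by
      obtain ⟨Q, hQ, hQP⟩ := (supportIdeal_le_iff P.1).mp hle
      exact hQ (PrimeDivisor.eq_of_le hQP ▸ hP)
    obtain ⟨n, hn⟩ := h d hd
    exact (ord_le_ord_iff P hy hx).mpr
      ⟨d ^ n, fun hmem => hdP (P.1.isPrime.mem_of_pow_mem n hmem), hn⟩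
  · intro h d hd
    rcases eq_or_ne d 0 with rfl | hd0
    · exact ⟨1, by simp⟩
    refine ⟨∑ P ∈ E.support, (ord P y).toNat,
      dvd_of_ord_le (mul_ne_zero (pow_ne_zero _ hd0) hx) hy fun P => ?_⟩
    rw [ord_mul P (pow_ne_zero _ hd0) hx, ord_pow P hd0]
    have hx' := ord_nonneg P x
    have hd' := ord_nonneg P d
    by_cases hP : E P = 0
    · have := h P hP
      have : 0 ≤ ((∑ P ∈ E.support, (ord P y).toNat : ℕ) : ℤ) * ord P d := by positivity
      omega
    · have h1 := (ord_pos_iff P hd0).mpr (mem_supportIdeal.mp hd P hP)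
      have h2 : (ord P y).toNat ≤ ∑ P ∈ E.support, (ord P y).toNat :=
        Finset.single_le_sum (f := fun P => (ord P y).toNat) (fun _ _ => Nat.zero_le _)
          (Finsupp.mem_support_iff.mpr hP)
      have h3 : ((ord P y).toNat : ℤ) ≤ ((∑ P ∈ E.support, (ord P y).toNat : ℕ) : ℤ) := by
        exact_mod_cast h2
      have h4 := Int.self_le_toNat (ord P y)
      nlinarith

/-! ### Linear equivalence -/

theorem LinearlyEquivalent.refl (D : WeilDivisor A) : LinearlyEquivalent D D :=
  ⟨1, 1, one_ne_zero, one_ne_zero, by simp⟩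

theorem LinearlyEquivalent.symm {D E : WeilDivisor A} (h : LinearlyEquivalent D E) :
    LinearlyEquivalent E D := by
  obtain ⟨a, b, ha, hb, rfl⟩ := h
  exact ⟨b, a, hb, ha, by abel⟩

theorem LinearlyEquivalent.add {D E D' E' : WeilDivisor A} (h : LinearlyEquivalent D E)
    (h' : LinearlyEquivalent D' E') : LinearlyEquivalent (D + D') (E + E') := by
  obtain ⟨a, b, ha, hb, rfl⟩ := h
  obtain ⟨a', b', ha', hb', rfl⟩ := h'
  refine ⟨a * a', b * b', mul_ne_zero ha ha', mul_ne_zero hb hb', ?_⟩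
  rw [div_mul ha ha', div_mul hb hb']
  abel

theorem LinearlyEquivalent.trans {D E F : WeilDivisor A} (h : LinearlyEquivalent D E)
    (h' : LinearlyEquivalent E F) : LinearlyEquivalent D F := by
  obtain ⟨a, b, ha, hb, rfl⟩ := h
  obtain ⟨a', b', ha', hb', rfl⟩ := h'
  refine ⟨a * a', b * b', mul_ne_zero ha ha', mul_ne_zero hb hb', ?_⟩
  rw [div_mul ha ha', div_mul hb hb']
  abel

theorem LinearlyEquivalent.neg {D E : WeilDivisor A} (h : LinearlyEquivalent D E) :
    LinearlyEquivalent (-D) (-E) := by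
  obtain ⟨a, b, ha, hb, rfl⟩ := h
  exact ⟨b, a, hb, ha, by abel⟩

theorem LinearlyEquivalent.zsmul {D E : WeilDivisor A} (h : LinearlyEquivalent D E) (n : ℤ) :
    LinearlyEquivalent (n • D) (n • E) := by
  induction n with
  | zero => simpa using .refl _
  | succ n ih => simpa [add_smul] using ih.add h
  | pred n ih =>
    rw [sub_smul, sub_smul, one_smul, one_smul, sub_eq_add_neg, sub_eq_add_neg]
    exact ih.add h.neg

theorem Coaffine.congr {D E : WeilDivisor A} (h : LinearlyEquivalent D E) (hD : Coaffine D) :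
    Coaffine E :=
  fun F hF hEF => hD F hF (h.trans hEF)

/-- An effective divisor that is linearly equivalent to zero is the divisor of a regular function
`f`, and its complement is the affine scheme `D(f)`. -/
theorem Coaffine.of_linearlyEquivalent_zero {D : WeilDivisor A} (h : LinearlyEquivalent D 0) :
    Coaffine D := by
  intro E hE hDE
  obtain ⟨a, b, ha, hb, hab⟩ := h.symm.trans hDE
  rw [zero_add] at hab
  obtain ⟨f, rfl⟩ := dvd_of_ord_le ha hb fun P => by
    have := hE P
    rw [hab] at this
    exact sub_nonneg.mp this
  have hf : f ≠ 0 := right_ne_zero_of_mul ha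
  rw [div_mul hb hf, add_sub_cancel_left] at hab
  subst hab
  have hfK : algebraMap A (FractionRing A) f ≠ 0 := by simpa using hf
  rw [hasAffineComplement_supp_iff (FractionRing A), Ideal.eq_top_iff_one]
  have hfJ : f ∈ supportIdeal (div f) := by
    refine mem_supportIdeal.mpr fun P hP => ?_
    by_contra hfP
    exact hP ((ord_eq_zero_iff P hf).mpr hfP)
  have hinv := (div_mem_regularFunctions_iff (FractionRing A) (E := div f) one_ne_zero hf).mpr
    fun P hP => by rw [ord_one]; exact hP.le
  have h1 : (⟨_, hinv⟩ : regularFunctions (FractionRing A) (supportIdeal (div f))) *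
      algebraMap A _ f = 1 := Subtype.ext (by simp [hfK])
  rw [← h1]
  exact Ideal.mul_mem_left _ _ (Ideal.mem_map_of_mem _ hfJ)

theorem StronglyCoaffine.iff_coaffine {D : WeilDivisor A} :
    StronglyCoaffine D ↔ ∀ n : ℤ, Coaffine (n • D) :=
  ⟨fun h n => (h n).elim id .of_linearlyEquivalent_zero, fun h n => .inl (h n)⟩

theorem StronglyCoaffine.congr {D E : WeilDivisor A} (h : LinearlyEquivalent D E)
    (hD : StronglyCoaffine D) : StronglyCoaffine E :=
  StronglyCoaffine.iff_coaffine.mpr fun n =>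
    (StronglyCoaffine.iff_coaffine.mp hD n).congr (h.zsmul n)

theorem AffineTrivial.congr {D E : WeilDivisor A} (h : LinearlyEquivalent D E)
    (hD : AffineTrivial D) : AffineTrivial E :=
  fun F hF => (hD F hF).congr (h.add (.refl F))

end Order

open Polynomial

/-! ### Divisors of the polynomial ring -/

theorem mem_cylinder {A : Type u} [CommRing A] [IsNoetherianRing A] {P : PrimeDivisor A}
    {f : A[X]} : f ∈ (cylinder P).1.asIdeal ↔ ∀ n, f.coeff n ∈ P.1.asIdeal :=
  Ideal.mem_map_C_iff

theorem C_mem_cylinder {A : Type u} [CommRing A] [IsNoetherianRing A] {P : PrimeDivisor A}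
    {a : A} : C a ∈ (cylinder P).1.asIdeal ↔ a ∈ P.1.asIdeal := by
  rw [mem_cylinder]
  refine ⟨fun h => by simpa using h 0, fun h n => ?_⟩
  rw [coeff_C]
  split_ifs
  exacts [h, zero_mem _]

theorem cylinder_injective {A : Type u} [CommRing A] [IsNoetherianRing A] :
    Function.Injective (cylinder (A := A)) := by
  intro P Q h
  refine Subtype.ext (PrimeSpectrum.ext (Ideal.ext fun a => ?_))
  rw [← C_mem_cylinder, h, C_mem_cylinder]

theorem pullback_apply_cylinder {A : Type u} [CommRing A] [IsNoetherianRing A]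
    (D : WeilDivisor A) (P : PrimeDivisor A) : pullback D (cylinder P) = D P :=
  Finsupp.mapDomain_apply cylinder_injective D P

theorem pullback_apply_of_forall_ne {A : Type u} [CommRing A] [IsNoetherianRing A]
    (D : WeilDivisor A) {Q : PrimeDivisor A[X]} (h : ∀ P, Q ≠ cylinder P) : pullback D Q = 0 :=
  Finsupp.mapDomain_of_notMem_range D Q fun ⟨P, hP⟩ => h P hP.symm

theorem exists_pullback_eq {A : Type u} [CommRing A] [IsNoetherianRing A] {E : WeilDivisor A[X]}
    (h : ∀ Q, (∀ P, Q ≠ cylinder P) → E Q = 0) : ∃ D : WeilDivisor A, pullback D = E := by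
  refine ⟨E.comapDomain cylinder cylinder_injective.injOn, Finsupp.ext fun Q => ?_⟩
  by_cases hQ : ∃ P, Q = cylinder P
  · obtain ⟨P, rfl⟩ := hQ
    rw [pullback_apply_cylinder, Finsupp.comapDomain_apply]
  · rw [pullback_apply_of_forall_ne _ (not_exists.mp hQ), h Q (not_exists.mp hQ)]

/-- A prime divisor of `Spec A[T]` that does not dominate `Spec A` is a cylinder. -/
theorem exists_eq_cylinder {A : Type u} [CommRing A] [IsDomain A] [IsNoetherianRing A]
    {Q : PrimeDivisor A[X]} {a : A} (ha : a ≠ 0) (haQ : C a ∈ Q.1.asIdeal) :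
    ∃ P, Q = cylinder P := by
  let p : Ideal A := Q.1.asIdeal.comap C
  have hp : p.IsPrime := Ideal.comap_isPrime _ _
  have hle : p.map C ≤ Q.1.asIdeal := Ideal.map_comap_le
  have hne : p.map (C : A →+* A[X]) ≠ ⊥ := by
    intro h
    have : C a ∈ p.map C := Ideal.mem_map_of_mem _ haQ
    rw [h, Ideal.mem_bot, C_eq_zero] at this
    exact ha this
  have h1 : 1 ≤ (p.map (C : A →+* A[X])).height := by
    rwa [Order.one_le_iff_ne_zero, Ne, Ideal.height_eq_zero_iff_eq_bot]
  have h2 : (p.map (C : A →+* A[X])).height ≤ 1 := Q.2 ▸ Ideal.height_mono hle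
  have heq : p.map C = Q.1.asIdeal := by
    have : (p.map (C : A →+* A[X])).FiniteHeight :=
      Ideal.finiteHeight_iff_lt.mpr (.inr (h2.trans_lt ENat.one_lt_top))
    exact Ideal.eq_of_le_of_height_le _ hle (by rwa [Q.2])
  have hheight : p.height = 1 := by
    have : (p.map (C : A →+* A[X])).LiesOver p := ⟨by rw [heq]; rfl⟩
    have h := Ideal.height_eq_height_add_of_liesOver_of_hasGoingDown p
      (P := p.map (C : A →+* A[X]))
    rw [le_antisymm h2 h1] at h
    simpa using h.symm
  exact ⟨⟨⟨p, hp⟩, hheight⟩, Subtype.ext (PrimeSpectrum.ext heq.symm)⟩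

/-- The denominators of the coefficients of a polynomial have a common multiple. -/
theorem exists_C_dvd {A : Type u} [CommRing A] {P : Ideal A} [P.IsPrime] {x : A} {f : A[X]}
    (h : ∀ n, ∃ u ∉ P, x ∣ u * f.coeff n) : ∃ u ∉ P, C x ∣ C u * f := by
  choose u hu hdvd using h
  refine ⟨∏ n ∈ f.support, u n, ?_, C_dvd_iff_dvd_coeff _ _ |>.mpr fun n => ?_⟩
  · exact fun hmem => by
      obtain ⟨n, -, hn⟩ := (Ideal.IsPrime.prod_mem_iff (p := P)).mp hmem
      exact hu n hn
  · rw [coeff_C_mul]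
    by_cases hn : n ∈ f.support
    · exact (hdvd n).trans (mul_dvd_mul_right (Finset.dvd_prod_of_mem u hn) _)
    · simp [notMem_support_iff.mp hn]

section Normal

variable {A : Type u} [CommRing A] [IsDomain A] [IsNoetherianRing A] [IsIntegrallyClosed A]

theorem ord_C_of_forall_ne {Q : PrimeDivisor A[X]} (h : ∀ P, Q ≠ cylinder P) {a : A} (ha : a ≠ 0) :
    ord Q (C a) = 0 := by
  rw [ord_eq_zero_iff Q (C_ne_zero.mpr ha)]
  intro haQ
  obtain ⟨P, hP⟩ := exists_eq_cylinder ha haQ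
  exact h P hP

theorem ord_cylinder_C (P : PrimeDivisor A) {a : A} (ha : a ≠ 0) :
    ord (cylinder P) (C a) = ord P a := by
  obtain ⟨π, hπ0, hπ⟩ := exists_ord_eq_one P
  have hCπ : ord (cylinder P) (C π) = 1 := by
    refine ord_eq_one _ (C_mem_cylinder.mpr ((ord_pos_iff P hπ0).mp (by omega)))
      (C_ne_zero.mpr hπ0) fun f hf => ?_
    obtain ⟨u, hu, hdvd⟩ := exists_C_dvd (P := P.1.asIdeal) (x := π) (f := f) fun n => by
      rcases eq_or_ne (f.coeff n) 0 with h0 | h0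
      · exact ⟨1, P.1.asIdeal.one_notMem, by simp [h0]⟩
      · have := (ord_pos_iff P h0).mpr (mem_cylinder.mp hf n)
        exact (ord_le_ord_iff P hπ0 h0).mp (by omega)
    exact ⟨C u, fun h => hu (C_mem_cylinder.mp h), hdvd⟩
  have hmono : ∀ {x y : A}, x ≠ 0 → y ≠ 0 → ord P x ≤ ord P y →
      ord (cylinder P) (C x) ≤ ord (cylinder P) (C y) := by
    intro x y hx hy h
    obtain ⟨u, hu, hdvd⟩ := (ord_le_ord_iff P hx hy).mp h
    refine (ord_le_ord_iff _ (C_ne_zero.mpr hx) (C_ne_zero.mpr hy)).mpr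
      ⟨C u, fun h => hu (C_mem_cylinder.mp h), ?_⟩
    rw [← C_mul]
    exact map_dvd C hdvd
  have hπn : ord P (π ^ (ord P a).toNat) = ord P a := by
    have := ord_nonneg P a
    rw [ord_pow P hπ0, hπ, mul_one]
    omega
  have hCπn : ord (cylinder P) (C (π ^ (ord P a).toNat)) = ord P a := by
    have := ord_nonneg P a
    rw [C_pow, ord_pow _ (C_ne_zero.mpr hπ0), hCπ, mul_one]
    omega
  have hπ' := pow_ne_zero (ord P a).toNat hπ0
  have h1 := hmono ha hπ' hπn.ge
  have h2 := hmono hπ' ha hπn.le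
  omega

/-- The order of a polynomial along a cylinder is the minimum of the orders of its coefficients
(Gauss's lemma). -/
theorem ord_cylinder_le (P : PrimeDivisor A) {f : A[X]} {n : ℕ} (hn : f.coeff n ≠ 0) :
    ord (cylinder P) f ≤ ord P (f.coeff n) := by
  obtain ⟨m, hm, hmin⟩ := Finset.exists_min_image f.support (fun i => ord P (f.coeff i))
    ⟨n, mem_support_iff.mpr hn⟩
  have hm0 := mem_support_iff.mp hm
  refine le_trans ?_ (hmin n (mem_support_iff.mpr hn))
  obtain ⟨u, hu, t, ht⟩ := exists_C_dvd (P := P.1.asIdeal) (x := f.coeff m) (f := f) fun i => by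
    rcases eq_or_ne (f.coeff i) 0 with h0 | h0
    · exact ⟨1, P.1.asIdeal.one_notMem, by simp [h0]⟩
    · exact (ord_le_ord_iff P hm0 h0).mp (hmin i (mem_support_iff.mpr h0))
  have hf : f ≠ 0 := by rintro rfl; simp at hn
  have hu0 : u ≠ 0 := by rintro rfl; exact hu (zero_mem _)
  have htm : t.coeff m = u := by
    have := congrArg (fun g => coeff g m) ht
    simp only [coeff_C_mul] at this
    exact mul_left_cancel₀ hm0 (by rw [← this, mul_comm])
  have htP : t ∉ (cylinder P).1.asIdeal := fun h => hu (htm ▸ mem_cylinder.mp h m)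
  have ht0 : t ≠ 0 := by rintro rfl; exact htP (zero_mem _)
  have h := congrArg (ord (cylinder P)) ht
  rw [ord_mul _ (C_ne_zero.mpr hu0) hf, ord_mul _ (C_ne_zero.mpr hm0) ht0, ord_cylinder_C P hu0,
    ord_cylinder_C P hm0, (ord_eq_zero_iff P hu0).mpr hu, (ord_eq_zero_iff _ ht0).mpr htP] at h
  omega

theorem pullback_div {a : A} (ha : a ≠ 0) : pullback (div a) = div (C a) := by
  ext Q
  rw [div_apply]
  by_cases h : ∃ P, Q = cylinder P
  · obtain ⟨P, rfl⟩ := h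
    rw [pullback_apply_cylinder, div_apply, ord_cylinder_C P ha]
  · rw [pullback_apply_of_forall_ne _ (not_exists.mp h), ord_C_of_forall_ne (not_exists.mp h) ha]

theorem LinearlyEquivalent.pullback {D E : WeilDivisor A} (h : LinearlyEquivalent D E) :
    LinearlyEquivalent (pullback D) (AffineClassGroup.pullback E) := by
  obtain ⟨a, b, ha, hb, rfl⟩ := h
  refine ⟨C a, C b, C_ne_zero.mpr ha, C_ne_zero.mpr hb, ?_⟩
  rw [map_add, map_sub, pullback_div ha, pullback_div hb]

/-- A prime divisor of `Spec A[T]` that dominates `Spec A` is the divisor of a polynomial `f` up to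
cylinders: `f` generates it in `K[T]`, where `K` is the field of fractions of `A`. -/
theorem exists_linearlyEquivalent_single (Q : PrimeDivisor A[X]) :
    ∃ D : WeilDivisor A, LinearlyEquivalent (Finsupp.single Q 1) (pullback D) := by
  by_cases hQ : ∃ P, Q = cylinder P
  · obtain ⟨P, rfl⟩ := hQ
    refine ⟨Finsupp.single P 1, ?_⟩
    rw [show pullback (Finsupp.single P (1 : ℤ)) = Finsupp.single (cylinder P) 1 from
      Finsupp.mapDomain_single]
    exact .refl _
  rw [not_exists] at hQ
  obtain ⟨g₀, hg₀Q, hg₀⟩ := Submodule.exists_mem_ne_zero_of_ne_bot Q.asIdeal_ne_bot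
  obtain ⟨f, ⟨hfQ, hf0⟩, hmin⟩ := WellFounded.has_min (measure natDegree).wf
    {g : A[X] | g ∈ Q.1.asIdeal ∧ g ≠ 0} ⟨g₀, hg₀Q, hg₀⟩
  have hC : ∀ Q' : PrimeDivisor A[X], (∀ P, Q' ≠ cylinder P) → ∀ {c : A}, c ≠ 0 →
      C c ∉ Q'.1.asIdeal := fun Q' hQ' c hc =>
    (ord_eq_zero_iff Q' (C_ne_zero.mpr hc)).mp (ord_C_of_forall_ne hQ' hc)
  have hfdeg : 0 < f.natDegree := by
    by_contra h
    obtain ⟨a, ha⟩ := natDegree_eq_zero.mp (Nat.eq_zero_of_not_pos h)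
    subst ha
    exact hC Q hQ (C_ne_zero.mp hf0) hfQ
  -- Division by `f` up to denominators in `A`: the leading terms are cancelled.
  have hdvd : ∀ (n : ℕ) (g : A[X]), g.natDegree < n → g ∈ Q.1.asIdeal →
      ∃ c : A, c ≠ 0 ∧ f ∣ C c * g := by
    intro n
    induction n with
    | zero => intro g hg; omega
    | succ n ih =>
      intro g hgn hgQ
      rcases eq_or_ne g 0 with rfl | hg0
      · exact ⟨1, one_ne_zero, by simp⟩
      have hdeg : f.natDegree ≤ g.natDegree := not_lt.mp (hmin g ⟨hgQ, hg0⟩)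
      have hrQ : f.cancelLeads g ∈ Q.1.asIdeal :=
        Ideal.sub_mem _ (Ideal.mul_mem_left _ _ hgQ) (Ideal.mul_mem_left _ _ hfQ)
      have hr := natDegree_cancelLeads_lt_of_natDegree_le_natDegree hdeg (hfdeg.trans_le hdeg)
      obtain ⟨c, hc, hcr⟩ := ih _ (by omega) hrQ
      refine ⟨c * f.leadingCoeff, mul_ne_zero hc (leadingCoeff_ne_zero.mpr hf0), ?_⟩
      rw [cancelLeads, tsub_eq_zero_iff_le.mpr hdeg, pow_zero, mul_one, mul_sub, ← mul_assoc,
        ← C_mul] at hcr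
      exact (dvd_sub_left (Dvd.intro_left _ (mul_assoc _ _ _))).mp hcr
  have hf1 : ord Q f = 1 := ord_eq_one Q hfQ hf0 fun g hg => by
    obtain ⟨c, hc, h⟩ := hdvd _ g (Nat.lt_succ_self _) hg
    exact ⟨C c, hC Q hQ hc, h⟩
  have hf' : ∀ Q', (∀ P, Q' ≠ cylinder P) → Q ≠ Q' → ord Q' f = 0 := by
    intro Q' hQ' hne
    rw [ord_eq_zero_iff Q' hf0]
    refine fun hfQ' => hne (PrimeDivisor.eq_of_le fun g hg => ?_)
    obtain ⟨c, hc, h⟩ := hdvd _ g (Nat.lt_succ_self _) hg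
    exact (Q'.1.isPrime.mem_or_mem (Q'.1.asIdeal.mem_of_dvd h hfQ')).resolve_left (hC Q' hQ' hc)
  obtain ⟨D, hD⟩ := exists_pullback_eq (E := Finsupp.single Q 1 - div f) fun Q' hQ' => by
    rw [Finsupp.sub_apply, div_apply]
    rcases eq_or_ne Q Q' with rfl | hne
    · rw [Finsupp.single_eq_same, hf1, sub_self]
    · rw [Finsupp.single_eq_of_ne hne.symm, hf' Q' hQ' hne, sub_self]
  refine ⟨D, 1, f, one_ne_zero, hf0, ?_⟩
  rw [hD, div_one, zero_sub, sub_eq_add_neg]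

/-- The pull-back `Cl A → Cl A[T]` of divisor classes is surjective. -/
theorem exists_linearlyEquivalent_pullback (E : WeilDivisor A[X]) :
    ∃ D : WeilDivisor A, LinearlyEquivalent E (pullback D) := by
  induction E using Finsupp.induction_linear with
  | zero => exact ⟨0, by rw [map_zero]; exact .refl _⟩
  | add E F hE hF =>
    obtain ⟨D, hD⟩ := hE
    obtain ⟨D', hD'⟩ := hF
    exact ⟨D + D', by rw [map_add]; exact hD.add hD'⟩
  | single Q n =>
    obtain ⟨D, hD⟩ := exists_linearlyEquivalent_single Q
    refine ⟨n • D, ?_⟩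
    rw [map_zsmul]
    simpa using hD.zsmul n

end Normal

/-! ### Restriction to the zero section -/

theorem mem_supp {A : Type u} [CommRing A] {E : WeilDivisor A} {p : PrimeSpectrum A} :
    p ∈ supp E ↔ ∃ P, E P ≠ 0 ∧ P.1.asIdeal ≤ p.asIdeal := by
  rw [← zeroLocus_supportIdeal, PrimeSpectrum.mem_zeroLocus, SetLike.coe_subset_coe,
    supportIdeal_le_iff]

/-- The zero section `Spec A → Spec A[T]` is an affine morphism, under which the complement of a
divisor of `Spec A` is the preimage of the complement of its pull-back. -/
theorem HasAffineComplement.of_pullback {A : Type u} [CommRing A] [IsNoetherianRing A]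
    {E : WeilDivisor A} (h : HasAffineComplement (supp (pullback E))) :
    HasAffineComplement (supp E) := by
  obtain ⟨U, hU, hUa⟩ := h
  let σ : Spec (CommRingCat.of A) ⟶ Spec (CommRingCat.of A[X]) :=
    Spec.map (CommRingCat.ofHom (evalRingHom 0))
  refine ⟨σ ⁻¹ᵁ U, ?_, hUa.preimage σ⟩
  ext p
  have h1 : p ∈ (σ ⁻¹ᵁ U : Set (Spec (CommRingCat.of A))) ↔
      PrimeSpectrum.comap (evalRingHom (0 : A)) p ∈ (supp (pullback E))ᶜ := by
    rw [← hU]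
    rfl
  refine h1.trans (not_congr (mem_supp.trans (Iff.trans ?_ mem_supp.symm)))
  constructor
  · rintro ⟨Q, hQ, hle⟩
    by_cases hcyl : ∃ P, Q = cylinder P
    · obtain ⟨P, rfl⟩ := hcyl
      rw [pullback_apply_cylinder] at hQ
      refine ⟨P, hQ, fun a ha => ?_⟩
      have h : eval 0 (C a) ∈ p.asIdeal := hle (C_mem_cylinder.mpr ha)
      rwa [eval_C] at h
    · exact absurd (pullback_apply_of_forall_ne E (not_exists.mp hcyl)) hQ
  · rintro ⟨P, hP, hle⟩
    refine ⟨cylinder P, by rwa [pullback_apply_cylinder], fun f hf => ?_⟩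
    have := hle (mem_cylinder.mp hf 0)
    rwa [coeff_zero_eq_eval_zero] at this

section Normal

variable {A : Type u} [CommRing A] [IsDomain A] [IsNoetherianRing A] [IsIntegrallyClosed A]

/-- Every divisor is bounded by the divisor of an element of `A`. -/
theorem exists_le_ord (D : WeilDivisor A) : ∃ e : A, e ≠ 0 ∧ D ≤ div e := by
  choose π hπ0 hπ using fun P : PrimeDivisor A => exists_ord_eq_one P
  have h : ∀ s : Finset (PrimeDivisor A), ∃ e : A, e ≠ 0 ∧ ∀ P ∈ s, D P ≤ ord P e := by
    intro s
    induction s using Finset.cons_induction with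
    | empty => exact ⟨1, one_ne_zero, by simp⟩
    | cons P s _ ih =>
      obtain ⟨e, he, h⟩ := ih
      have hP := pow_ne_zero (D P).toNat (hπ0 P)
      refine ⟨π P ^ (D P).toNat * e, mul_ne_zero hP he, fun Q hQ => ?_⟩
      have h1 := ord_nonneg Q e
      have h2 := ord_nonneg Q (π P ^ (D P).toNat)
      rw [ord_mul Q hP he]
      rcases Finset.mem_cons.mp hQ with rfl | hQ
      · rw [ord_pow Q (hπ0 Q), hπ Q] at h2 ⊢
        omega
      · have := h Q hQ
        omega
  obtain ⟨e, he, h⟩ := h D.support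
  refine ⟨e, he, fun P => ?_⟩
  rw [div_apply]
  by_cases hP : D P = 0
  · rw [hP]
    exact ord_nonneg P e
  · exact h P (Finsupp.mem_support_iff.mpr hP)

/-! ### Sections of a pulled back divisor -/

section Section

/-! In the following lemmas `s` is a section of the pull-back of the divisor `D`, i.e.
`pullback D + div s` is effective, and `c` is a section of `D` that vanishes along prime divisors at
least as much as `s` does along their cylinders; a coefficient of `s` has this property. -/

variable {D : WeilDivisor A} {s : A[X]} {c : A}

theorem pullback_add_div_apply_cylinder (P : PrimeDivisor A) :
    (pullback D + div s) (cylinder P) = D P + ord (cylinder P) s := by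
  rw [Finsupp.add_apply, pullback_apply_cylinder, div_apply]

theorem pullback_add_div_apply_of_forall_ne {Q : PrimeDivisor A[X]} (hQ : ∀ P, Q ≠ cylinder P) :
    (pullback D + div s) Q = ord Q s := by
  rw [Finsupp.add_apply, pullback_apply_of_forall_ne D hQ, div_apply, zero_add]

/-- The quotient `c / s` is regular where `s` does not vanish. -/
theorem C_div_mem_regularFunctions (hs : s ≠ 0) (hc : c ≠ 0)
    (hle : ∀ P, ord (cylinder P) s ≤ ord P c) :
    algebraMap A[X] (FractionRing A[X]) (C c) / algebraMap A[X] (FractionRing A[X]) s ∈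
      regularFunctions (FractionRing A[X]) (supportIdeal (pullback D + div s)) := by
  refine (div_mem_regularFunctions_iff _ (C_ne_zero.mpr hc) hs).mpr fun Q hQ => ?_
  by_cases hcyl : ∃ P, Q = cylinder P
  · obtain ⟨P, rfl⟩ := hcyl
    rw [ord_cylinder_C P hc]
    exact hle P
  · rw [pullback_add_div_apply_of_forall_ne (not_exists.mp hcyl)] at hQ
    rw [hQ]
    exact ord_nonneg Q _

/-- A function that is regular where `c` does not vanish becomes regular where `s` does not vanish
after multiplication by a power of `c / s`. -/
theorem exists_pow_mul_mem_regularFunctions (hs : s ≠ 0) (hc : c ≠ 0)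
    (hle : ∀ P, ord (cylinder P) s ≤ ord P c) {x y : A} (hx : x ≠ 0) (hy : y ≠ 0)
    (h : ∀ P, (D + div c) P = 0 → ord P y ≤ ord P x) :
    ∃ m : ℕ, algebraMap A[X] (FractionRing A[X]) (C c ^ m * C x) /
      algebraMap A[X] (FractionRing A[X]) (s ^ m * C y) ∈
      regularFunctions (FractionRing A[X]) (supportIdeal (pullback D + div s)) := by
  have hc' := C_ne_zero.mpr hc
  have hx' := C_ne_zero.mpr hx
  have hy' := C_ne_zero.mpr hy
  let m : ℕ := ∑ P ∈ (D + div c).support, (ord P y).toNat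
  have hcm := pow_ne_zero m hc'
  have hsm := pow_ne_zero m hs
  refine ⟨m, (div_mem_regularFunctions_iff _ (mul_ne_zero hcm hx')
    (mul_ne_zero hsm hy')).mpr fun Q hQ => ?_⟩
  rw [ord_mul Q hcm hx', ord_mul Q hsm hy', ord_pow Q hc', ord_pow Q hs]
  by_cases hcyl : ∃ P, Q = cylinder P
  · obtain ⟨P, rfl⟩ := hcyl
    rw [pullback_add_div_apply_cylinder] at hQ
    rw [ord_cylinder_C P hc, ord_cylinder_C P hx, ord_cylinder_C P hy]
    have hEP : (D + div c) P = D P + ord P c := rfl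
    have hP := hle P
    by_cases hE : (D + div c) P = 0
    · have h1 := h P hE
      rw [show ord (cylinder P) s = ord P c by omega]
      omega
    · have h1 : (ord P y).toNat ≤ m :=
        Finset.single_le_sum (f := fun P => (ord P y).toNat) (fun _ _ => Nat.zero_le _)
          (Finsupp.mem_support_iff.mpr hE)
      have h2 := Int.self_le_toNat (ord P y)
      have h3 : ((ord P y).toNat : ℤ) ≤ m := by exact_mod_cast h1
      have h4 := ord_nonneg P x
      have h5 : ord (cylinder P) s + 1 ≤ ord P c := by omega
      have h6 : (m : ℤ) * (ord (cylinder P) s + 1) ≤ m * ord P c :=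
        mul_le_mul_of_nonneg_left h5 (Int.natCast_nonneg m)
      linarith
  · have hcyl := not_exists.mp hcyl
    rw [pullback_add_div_apply_of_forall_ne hcyl] at hQ
    rw [hQ, ord_C_of_forall_ne hcyl hc, ord_C_of_forall_ne hcyl hx, ord_C_of_forall_ne hcyl hy]

/-- An element of a high power of the ideal of the zeros of `c` is, up to a factor `c / s`, a
function that vanishes where `s` does. -/
theorem exists_mul_eq_of_mem_pow (hs : s ≠ 0) (hc : c ≠ 0) (hE : 0 ≤ pullback D + div s)
    {a : A} {N : ℕ} (hN : ∀ P, (D + div c) P < N) (ha : a ∈ supportIdeal (D + div c) ^ N) :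
    ∃ g ∈ supportIdeal (pullback D + div s), C c * g = C a * s := by
  rcases eq_or_ne a 0 with rfl | ha0
  · exact ⟨0, zero_mem _, by simp⟩
  have hc' := C_ne_zero.mpr hc
  have ha' := C_ne_zero.mpr ha0
  have hord : ∀ Q : PrimeDivisor A[X], ord Q (C c) ≤ ord Q (C a * s) ∧
      ((pullback D + div s) Q ≠ 0 → ord Q (C c) < ord Q (C a * s)) := by
    intro Q
    have hEQ : 0 ≤ (pullback D + div s) Q := hE Q
    rw [ord_mul Q ha' hs]
    by_cases hcyl : ∃ P, Q = cylinder P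
    · obtain ⟨P, rfl⟩ := hcyl
      rw [pullback_add_div_apply_cylinder] at hEQ ⊢
      rw [ord_cylinder_C P hc, ord_cylinder_C P ha0]
      have hEP : (D + div c) P = D P + ord P c := rfl
      have h1 := ord_nonneg P a
      by_cases hP : (D + div c) P = 0
      · omega
      · have hle : supportIdeal (D + div c) ≤ P.1.asIdeal := fun d hd =>
          mem_supportIdeal.mp hd P hP
        have h2 := le_ord_of_mem_pow P ha0 (Ideal.pow_right_mono hle N ha)
        have h3 := hN P
        omega
    · have hcyl := not_exists.mp hcyl
      rw [pullback_add_div_apply_of_forall_ne hcyl] at hEQ ⊢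
      rw [ord_C_of_forall_ne hcyl hc, ord_C_of_forall_ne hcyl ha0]
      omega
  obtain ⟨g, hg⟩ := dvd_of_ord_le (mul_ne_zero ha' hs) hc' fun Q => (hord Q).1
  refine ⟨g, mem_supportIdeal.mpr fun Q hQ => ?_, hg.symm⟩
  have hg0 : g ≠ 0 := by
    rintro rfl
    exact mul_ne_zero ha' hs (by rw [hg, mul_zero])
  have := (hord Q).2 hQ
  rw [hg, ord_mul Q hc' hg0] at this
  exact (ord_pos_iff Q hg0).mp (by omega)

/-- On the complement of the zeros of `s`, a power of `c / s` is a combination of functions that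
vanish along the zeros of `s`. If `1 = ∑ a_j b_j` where `b_j` is regular off the zeros of `c` and
`a_j` vanishes there to high order, then `(c / s) ^ m = ∑ (a_j s / c) (b_j (c / s) ^ (m + 1))`. -/
theorem exists_pow_mem_map_supportIdeal (hs : s ≠ 0) (hc : c ≠ 0)
    (hle : ∀ P, ord (cylinder P) s ≤ ord P c) (hE : 0 ≤ pullback D + div s)
    (h : HasAffineComplement (supp (D + div c))) :
    ∃ m : ℕ, (⟨_, C_div_mem_regularFunctions hs hc hle⟩ : regularFunctions (FractionRing A[X])
      (supportIdeal (pullback D + div s))) ^ m ∈ (supportIdeal (pullback D + div s)).map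
        (algebraMap A[X] (regularFunctions (FractionRing A[X])
          (supportIdeal (pullback D + div s)))) := by
  set f : regularFunctions (FractionRing A[X]) (supportIdeal (pullback D + div s)) :=
    ⟨_, C_div_mem_regularFunctions hs hc hle⟩ with hf
  have hfs : algebraMap A[X] (FractionRing A[X]) s * f =
      algebraMap A[X] (FractionRing A[X]) (C c) := by
    have : algebraMap A[X] (FractionRing A[X]) s ≠ 0 := by simpa using hs
    rw [hf]
    field_simp
  clear_value f
  clear hf
  obtain ⟨N, hN⟩ : ∃ N : ℕ, ∀ P, (D + div c) P < N := by
    refine ⟨∑ P ∈ (D + div c).support, ((D + div c) P).toNat + 1, fun P => ?_⟩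
    by_cases hP : (D + div c) P = 0
    · rw [hP]; positivity
    · have := Finset.single_le_sum (f := fun P => ((D + div c) P).toNat)
        (fun _ _ => Nat.zero_le _) (Finsupp.mem_support_iff.mpr hP)
      omega
  rw [hasAffineComplement_supp_iff (FractionRing A)] at h
  have htop : (supportIdeal (D + div c) ^ N).map
      (algebraMap A (regularFunctions (FractionRing A) (supportIdeal (D + div c)))) = ⊤ := by
    rw [Ideal.map_pow, h, Ideal.top_pow]
  let φ := algebraMap A (FractionRing A)
  let ψ : A →+* FractionRing A[X] := (algebraMap A[X] (FractionRing A[X])).comp C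
  have hψ : Function.Injective ψ := (IsFractionRing.injective A[X] _).comp C_injective
  -- The statement for `1` is proved for all elements of the ideal, which are written as fractions
  -- `x / y` of elements of `A` in order to be compared in the two fields of fractions.
  have key : ∀ b ∈ (supportIdeal (D + div c) ^ N).map
      (algebraMap A (regularFunctions (FractionRing A) (supportIdeal (D + div c)))),
      ∃ x y : A, ∃ m : ℕ, y ≠ 0 ∧ φ y * b = φ x ∧
      ∃ β ∈ (supportIdeal (pullback D + div s)).map (algebraMap A[X] (regularFunctions
        (FractionRing A[X]) (supportIdeal (pullback D + div s)))),
        ψ y * β = ψ x * f ^ m := by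
    intro b hb
    refine Submodule.span_induction ?_ ?_ ?_ ?_ hb
    · rintro _ ⟨a, ha, rfl⟩
      obtain ⟨g, hg, hcg⟩ := exists_mul_eq_of_mem_pow hs hc hE hN ha
      refine ⟨a, 1, 0, one_ne_zero, by simp [φ], _,
        Ideal.mul_mem_left _ f (Ideal.mem_map_of_mem _ hg), ?_⟩
      have hs' : algebraMap A[X] (FractionRing A[X]) s ≠ 0 := by simpa using hs
      apply mul_left_cancel₀ hs'
      have := congrArg (algebraMap A[X] (FractionRing A[X])) hcg
      rw [map_mul, map_mul, ← hfs] at this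
      simp only [map_one, one_mul, pow_zero, mul_one, Subalgebra.coe_mul,
        Subalgebra.coe_algebraMap, ψ, RingHom.comp_apply]
      linear_combination this
    · exact ⟨0, 1, 0, one_ne_zero, by simp, 0, zero_mem _, by simp⟩
    · rintro b b' - - ⟨x, y, m, hy, hb, β, hβ, h1⟩ ⟨x', y', m', hy', hb', β', hβ', h1'⟩
      refine ⟨x * y' + x' * y, y * y', m + m', mul_ne_zero hy hy', ?_, f ^ m' * β + f ^ m * β',
        add_mem (Ideal.mul_mem_left _ _ hβ) (Ideal.mul_mem_left _ _ hβ'), ?_⟩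
      · simp only [map_add, map_mul, ← hb, ← hb', Subalgebra.coe_add]; ring
      · simp only [map_add, map_mul, Subalgebra.coe_add, Subalgebra.coe_mul, Subalgebra.coe_pow]
        linear_combination (ψ y' * (f : FractionRing A[X]) ^ m') * h1 +
          (ψ y * (f : FractionRing A[X]) ^ m) * h1'
    · rintro ⟨r, hr⟩ b - ⟨x, y, m, hy, hb, β, hβ, h1⟩
      obtain ⟨x', y', hy', rfl⟩ := IsFractionRing.div_surjective (A := A) r
      have hy0 : y' ≠ 0 := nonZeroDivisors.ne_zero hy'
      rcases eq_or_ne x' 0 with rfl | hx0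
      · refine ⟨0, 1, 0, one_ne_zero, ?_, 0, zero_mem _, by simp⟩
        simp
      obtain ⟨k, hk⟩ := exists_pow_mul_mem_regularFunctions hs hc hle hx0 hy0
        ((div_mem_regularFunctions_iff _ hx0 hy0).mp hr)
      have hφ : φ y' ≠ 0 := by simpa [φ] using hy0
      refine ⟨x' * x, y' * y, k + m, mul_ne_zero hy0 hy, ?_, _,
        Ideal.mul_mem_left _ ⟨_, hk⟩ hβ, ?_⟩
      · simp only [map_mul, ← hb, smul_eq_mul, Subalgebra.coe_mul]
        change φ y' * φ y * (φ x' / φ y' * b) = _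
        field_simp
      · have hs' : algebraMap A[X] (FractionRing A[X]) s ≠ 0 := by simpa using hs
        have hψ' : ψ y' ≠ 0 := by rwa [Ne, map_eq_zero_iff _ hψ]
        simp only [map_mul, map_pow, Subalgebra.coe_mul, ← hfs]
        change ψ y' * ψ y * ((algebraMap A[X] (FractionRing A[X]) s * f) ^ k * ψ x' /
          (algebraMap A[X] (FractionRing A[X]) s ^ k * ψ y') * β) = _
        rw [pow_add]
        field_simp
        linear_combination (ψ x' * (f : FractionRing A[X]) ^ k *
          algebraMap A[X] (FractionRing A[X]) s ^ k) * h1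
  obtain ⟨x, y, m, hy, hxy, β, hβ, h1⟩ := key 1 (htop ▸ Submodule.mem_top)
  have hxy' : y = x := IsFractionRing.injective A (FractionRing A) (by simpa [φ] using hxy)
  subst hxy'
  refine ⟨m, ?_⟩
  have hψ' : ψ y ≠ 0 := by rwa [Ne, map_eq_zero_iff _ hψ]
  have hβ' : β = f ^ m := Subtype.ext (by simpa using mul_left_cancel₀ hψ' h1)
  rwa [← hβ']

/-- The complement of the zeros of `s` is affine if the complements of the zeros of its
coefficients are: the functions `f_i = s_i / s` are regular on it, satisfy `∑ f_i T ^ i = 1`, and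
the loci where they do not vanish are affine. -/
theorem hasAffineComplement_of_coeff (hs : s ≠ 0) (hE : 0 ≤ pullback D + div s)
    (h : ∀ n, s.coeff n ≠ 0 → HasAffineComplement (supp (D + div (s.coeff n)))) :
    HasAffineComplement (supp (pullback D + div s)) := by
  rw [hasAffineComplement_supp_iff (FractionRing A[X])]
  by_contra hne
  obtain ⟨M, hM, hle⟩ := Ideal.exists_le_maximal _ hne
  have hs' : algebraMap A[X] (FractionRing A[X]) s ≠ 0 := by simpa using hs
  -- Modulo a maximal ideal that contains the functions vanishing on the zeros of `s`, all the
  -- `f_i` are zero.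
  have hmem : ∀ n, ∃ f ∈ M, (f : FractionRing A[X]) =
      algebraMap A[X] (FractionRing A[X]) (C (s.coeff n)) /
        algebraMap A[X] (FractionRing A[X]) s := by
    intro n
    by_cases hn : s.coeff n = 0
    · exact ⟨0, zero_mem _, by simp [hn]⟩
    · obtain ⟨m, hm⟩ := exists_pow_mem_map_supportIdeal hs hn (fun P => ord_cylinder_le P hn) hE
        (h n hn)
      exact ⟨_, hM.isPrime.mem_of_pow_mem m (hle hm), rfl⟩
  choose f hf hfs using hmem
  apply hM.ne_top
  rw [Ideal.eq_top_iff_one]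
  have hsum : ∑ n ∈ s.support, algebraMap A[X] (regularFunctions (FractionRing A[X])
      (supportIdeal (pullback D + div s))) (X ^ n) * f n = 1 := by
    apply Subtype.ext
    rw [AddSubmonoidClass.coe_finsetSum]
    simp only [Subalgebra.coe_mul, Subalgebra.coe_algebraMap, hfs, Subalgebra.coe_one]
    simp_rw [← mul_div_assoc, ← map_mul]
    rw [← Finset.sum_div, ← map_sum, Finset.sum_congr rfl fun n _ => mul_comm (X ^ n) _,
      ← s.as_sum_support_C_mul_X_pow, div_self hs']
  rw [← hsum]
  exact sum_mem fun n _ => Ideal.mul_mem_left _ _ (hf n)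

end Section

/-! ### Pull-back of coaffine divisors -/

/-- A section of the pull-back of `D` is a polynomial whose coefficients are sections of `D`, so
that `hasAffineComplement_of_coeff` applies. -/
theorem Coaffine.pullback {D : WeilDivisor A} (hD : Coaffine D) :
    Coaffine (AffineClassGroup.pullback D) := by
  rintro E hE ⟨f, g, hf, hg, rfl⟩
  obtain ⟨e, he, hDe⟩ := exists_le_ord D
  have he' := C_ne_zero.mpr he
  -- The section `f / g` of the pull-back of `D` is a polynomial up to the denominator `e`.
  obtain ⟨s, hs⟩ := dvd_of_ord_le (mul_ne_zero he' hf) hg fun Q => by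
    have hEQ : 0 ≤ AffineClassGroup.pullback D Q + (ord Q f - ord Q g) := hE Q
    rw [ord_mul Q he' hf]
    by_cases hcyl : ∃ P, Q = cylinder P
    · obtain ⟨P, rfl⟩ := hcyl
      rw [pullback_apply_cylinder] at hEQ
      have : D P ≤ ord P e := hDe P
      rw [ord_cylinder_C P he]
      omega
    · rw [pullback_apply_of_forall_ne D (not_exists.mp hcyl)] at hEQ
      have := ord_nonneg Q (C e)
      omega
  have hs0 : s ≠ 0 := by
    rintro rfl
    exact mul_ne_zero he' hf (by rw [hs, mul_zero])
  have hdiv : AffineClassGroup.pullback D + (div f - div g) =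
      AffineClassGroup.pullback (D - div e) + div s := by
    have := congrArg div hs
    rw [div_mul he' hf, div_mul hg hs0] at this
    rw [map_sub, pullback_div he, ← sub_eq_zero]
    rw [← sub_eq_zero] at this
    rw [← this]
    abel
  rw [hdiv] at hE ⊢
  refine hasAffineComplement_of_coeff hs0 hE fun n hn => hD _ (fun P => ?_) ?_
  · have h1 := hE (cylinder P)
    rw [pullback_add_div_apply_cylinder] at h1
    have h2 := ord_cylinder_le P hn
    have h3 : (D - div e + div (s.coeff n)) P = (D - div e) P + ord P (s.coeff n) := rfl
    rw [h3]
    exact h1.trans (by omega)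
  · exact ⟨s.coeff n, e, hn, he, by abel⟩

theorem Coaffine.of_pullback {D : WeilDivisor A} (h : Coaffine (AffineClassGroup.pullback D)) :
    Coaffine D := by
  intro E hE hDE
  refine (h _ (fun Q => ?_) hDE.pullback).of_pullback
  by_cases hcyl : ∃ P, Q = cylinder P
  · obtain ⟨P, rfl⟩ := hcyl
    rw [pullback_apply_cylinder]
    exact hE P
  · rw [pullback_apply_of_forall_ne E (not_exists.mp hcyl)]
    rfl

theorem stronglyCoaffine_pullback_iff {D : WeilDivisor A} :
    StronglyCoaffine (pullback D) ↔ StronglyCoaffine D := by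
  simp only [StronglyCoaffine.iff_coaffine, ← map_zsmul]
  exact forall_congr' fun n => ⟨.of_pullback, .pullback⟩

/-- This uses that every strongly coaffine divisor of `Spec A[T]` is linearly equivalent to a
pull-back. -/
theorem affineTrivial_pullback_iff {D : WeilDivisor A} :
    AffineTrivial (pullback D) ↔ AffineTrivial D := by
  constructor
  · intro h E hE
    rw [← stronglyCoaffine_pullback_iff, map_add]
    exact h _ (stronglyCoaffine_pullback_iff.mpr hE)
  · intro h E hE
    obtain ⟨F, hF⟩ := exists_linearlyEquivalent_pullback E
    refine StronglyCoaffine.congr ((LinearlyEquivalent.refl _).add hF.symm) ?_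
    rw [← map_add, stronglyCoaffine_pullback_iff]
    exact h F (stronglyCoaffine_pullback_iff.mp (hE.congr hF))

theorem AffineTrivial.of_linearlyEquivalent_zero {D : WeilDivisor A}
    (h : LinearlyEquivalent D 0) : AffineTrivial D :=
  AffineTrivial.congr h.symm (zero_mem (affineTrivialSubgroup A))

end Normal

/-! ### Hypersurfaces and supports of divisors -/

theorem isHypersurface_supp {A : Type u} [CommRing A] (E : WeilDivisor A) :
    IsHypersurface (supp E) := by
  rw [← zeroLocus_supportIdeal]
  refine ⟨PrimeSpectrum.isClosed_zeroLocus _, fun p hp => ?_⟩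
  rw [PrimeSpectrum.vanishingIdeal_zeroLocus_eq_radical, Ideal.radical_minimalPrimes] at hp
  obtain ⟨P, hP, hle⟩ := (supportIdeal_le_iff ⟨p, hp.1.1⟩).mp hp.1.2
  have hP' : supportIdeal E ≤ P.1.asIdeal := (supportIdeal_le_iff P.1).mpr ⟨P, hP, le_rfl⟩
  rw [le_antisymm (hp.2 ⟨P.1.isPrime, hP'⟩ hle) hle]
  exact P.2

theorem IsHypersurface.exists_eq_supp {A : Type u} [CommRing A] [IsNoetherianRing A]
    {Z : Set (PrimeSpectrum A)} (hZ : IsHypersurface Z) :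
    ∃ E : WeilDivisor A, 0 ≤ E ∧ Z = supp E := by
  obtain ⟨hclosed, hheight⟩ := hZ
  let I := PrimeSpectrum.vanishingIdeal Z
  have hfin : {P : PrimeDivisor A | P.1.asIdeal ∈ I.minimalPrimes}.Finite :=
    Set.Finite.of_injOn (f := fun P : PrimeDivisor A => P.1.asIdeal) (t := I.minimalPrimes)
      (fun P hP => hP) (fun P _ Q _ h => Subtype.ext (PrimeSpectrum.ext h))
      (Ideal.finite_minimalPrimes_of_isNoetherianRing A I)
  classical
  let E : WeilDivisor A := Finsupp.onFinset hfin.toFinset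
    (fun P => if P.1.asIdeal ∈ I.minimalPrimes then 1 else 0) (by simp)
  have hE : ∀ P, E P ≠ 0 ↔ P.1.asIdeal ∈ I.minimalPrimes := fun P => by simp [E]
  refine ⟨E, fun P => ?_, ?_⟩
  · simp only [E, Finsupp.onFinset_apply, Finsupp.zero_apply]
    split_ifs <;> simp
  ext p
  rw [mem_supp, ← hclosed.closure_eq, ← PrimeSpectrum.zeroLocus_vanishingIdeal_eq_closure,
    PrimeSpectrum.mem_zeroLocus, SetLike.coe_subset_coe]
  constructor
  · intro hle
    obtain ⟨q, hq, hqp⟩ := Ideal.exists_minimalPrimes_le hle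
    exact ⟨⟨⟨q, hq.1.1⟩, hheight q hq⟩, (hE _).mpr hq, hqp⟩
  · rintro ⟨P, hP, hle⟩
    exact ((hE P).mp hP).1.2.trans hle

end AffineClassGroup

end

theorem mainTheorem2 (A : Type u) [CommRing A] [IsDomain A] [IsNoetherianRing A]
    [IsIntegrallyClosed A] :
    (∃ e : AffineClassGroup.ACl A ≃+ AffineClassGroup.ACl (Polynomial A),
      ∀ D : AffineClassGroup.WeilDivisor A,
        e (AffineClassGroup.ACl.mk D) =
          AffineClassGroup.ACl.mk (AffineClassGroup.pullback D)) ∧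
    ((∀ Z : Set (PrimeSpectrum A),
        AffineClassGroup.IsHypersurface Z → AffineClassGroup.HasAffineComplement Z) →
      ∀ Z : Set (PrimeSpectrum (Polynomial A)),
        AffineClassGroup.IsHypersurface Z → AffineClassGroup.HasAffineComplement Z) := by
  open AffineClassGroup in
  constructor
  · let φ : ACl A →+ ACl (Polynomial A) :=
      QuotientAddGroup.map _ _ pullback fun D hD => affineTrivial_pullback_iff.mpr hD
    have hφ : Function.Bijective φ := by
      constructor
      · rw [injective_iff_map_eq_zero]
        intro x hx
        obtain ⟨D, rfl⟩ := QuotientAddGroup.mk_surjective x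
        exact (QuotientAddGroup.eq_zero_iff D).mpr
          (affineTrivial_pullback_iff.mp ((QuotientAddGroup.eq_zero_iff (pullback D)).mp hx))
      · intro x
        obtain ⟨E, rfl⟩ := QuotientAddGroup.mk_surjective x
        obtain ⟨D, hD⟩ := exists_linearlyEquivalent_pullback E
        refine ⟨ACl.mk D, QuotientAddGroup.eq.mpr (AffineTrivial.of_linearlyEquivalent_zero ?_)⟩
        rw [← neg_add_cancel (pullback D)]
        exact (LinearlyEquivalent.refl _).add hD
    exact ⟨AddEquiv.ofBijective φ hφ, fun D => rfl⟩
  · intro h Z hZ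
    obtain ⟨E, hE, rfl⟩ := hZ.exists_eq_supp
    obtain ⟨D, hD⟩ := exists_linearlyEquivalent_pullback E
    have hcoaffine : Coaffine D := fun F _ _ => h _ (isHypersurface_supp F)
    exact hcoaffine.pullback E hE hD.symm
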